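/- Consider the square lattice $\mathbb{Z}^2$ with edge set $E=E(\mathbb{Z}^2)$, and let $\mu$ be an edge percolation measure on $\mathbb{Z}^2$, i.e. a probability measure on $\{0,1\}^{E}$ with the product $\sigma$-algebra ($1$ means open, $0$ means closed). Suppose that $\mu$ is invariant and ergodic under the translation action of $\mathbb{Z}^2$, and that $\mu$ has (uniform) finite energy: there is $\delta>0$ such that for every edge $e\in E$ the conditional probability $\mu(\omega_e=1\mid \omega_{E\setminus\{e\}})$ lies in $[\delta,1-\delta]$ almost surely. Let $\mu^*$ be the dual measure, i.e. the law of the dual configuration on the dual lattice, in which a dual edge is open if and only if the primal edge that it crosses is closed; the dual lattice is identified with $\mathbb{Z}^2$ by identifying the plaquette centred at $(x+\tfrac12,y+\tfrac12)$ with the vertex $(x,y)$. Let $\mu_{\mathrm{hp}}$ and $\mu^*_{\mathrm{hp}}$ denote the marginals of $\mu$ and $\mu^*$ on the edges with both endpoints in the upper half-plane $\mathbb{Z}\times\mathbb{Z}_{\ge 0}$. A cluster is a connected component of the graph formed by all vertices of the half-plane and the open edges. Then one of the following holds: 1. Almost surely $\mu_{\mathrm{hp}}$ has a unique infinite cluster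 and $\mu^*_{\mathrm{hp}}$ has no infinite cluster. 2. Almost surely $\mu^*_{\mathrm{hp}}$ has a unique infinite cluster and $\mu_{\mathrm{hp}}$ has no infinite cluster. 3. Almost surely neither $\mu_{\mathrm{hp}}$ nor $\mu^*_{\mathrm{hp}}$ has an infinite cluster. -/

import Mathlib

open MeasureTheory

namespace Percolation

/-- The square lattice: the Cayley graph of `ℤ²` with respect to the generators `(1,0), (0,1)`. -/
def squareLattice : SimpleGraph (ℤ × ℤ) :=
  SimpleGraph.circulantGraph {((1 : ℤ), (0 : ℤ)), ((0 : ℤ), (1 : ℤ))}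

/-- The edges of the square lattice: `horizontal x y` joins `(x, y)` and `(x + 1, y)`, and
`vertical x y` joins `(x, y)` and `(x, y + 1)`. -/
inductive Edge where
  | horizontal (x y : ℤ) : Edge
  | vertical (x y : ℤ) : Edge

/-- The unordered pair of endpoints of an edge. -/
def Edge.ends : Edge → Sym2 (ℤ × ℤ)
  | .horizontal x y => s((x, y), (x + 1, y))
  | .vertical x y => s((x, y), (x, y + 1))

/-- Taking endpoints identifies `Edge` with the edge set of the square lattice. -/
theorem Edge.bijOn_ends : Set.BijOn Edge.ends Set.univ squareLattice.edgeSet := by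
  refine ⟨?_, ?_, ?_⟩
  · rintro (⟨x, y⟩ | ⟨x, y⟩) - <;>
      simp [Edge.ends, squareLattice, SimpleGraph.circulantGraph]
  · rintro (⟨x, y⟩ | ⟨x, y⟩) - (⟨x', y'⟩ | ⟨x', y'⟩) - h <;>
      simp only [Edge.ends, Sym2.eq_iff, Prod.mk.injEq] at h <;>
      simp only [Edge.horizontal.injEq, Edge.vertical.injEq, reduceCtorEq] <;> omega
  · rintro p hp
    induction p using Sym2.ind with
    | _ u v =>
      obtain ⟨a, b⟩ := u
      obtain ⟨c, d⟩ := v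
      simp only [squareLattice, SimpleGraph.mem_edgeSet, SimpleGraph.circulantGraph,
        SimpleGraph.fromRel_adj, Prod.mk_sub_mk, Set.mem_insert_iff, Set.mem_singleton_iff,
        Prod.mk.injEq] at hp
      obtain ⟨-, (h | h) | (h | h)⟩ := hp
      · refine ⟨.horizontal c d, trivial, ?_⟩
        exact Sym2.eq_iff.2 (by simp only [Prod.mk.injEq, true_and, and_true]; omega)
      · refine ⟨.vertical c d, trivial, ?_⟩
        exact Sym2.eq_iff.2 (by simp only [Prod.mk.injEq, true_and, and_true]; omega)
      · refine ⟨.horizontal a b, trivial, ?_⟩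
        exact Sym2.eq_iff.2 (by simp only [Prod.mk.injEq, true_and, and_true]; omega)
      · refine ⟨.vertical a b, trivial, ?_⟩
        exact Sym2.eq_iff.2 (by simp only [Prod.mk.injEq, true_and, and_true]; omega)

/-- Percolation configurations (`true` is open, `false` is closed), with the product `σ`-algebra. -/
abbrev Config : Type := Edge → Bool

/-- Translation of an edge by a vector. -/
def Edge.shift (a : ℤ × ℤ) : Edge → Edge
  | .horizontal x y => .horizontal (x + a.1) (y + a.2)
  | .vertical x y => .vertical (x + a.1) (y + a.2)

/-- The translation action of `ℤ²` on configurations: an edge is open in `a +ᵥ ω` if and only if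
its translate by `-a` is open in `ω`. -/
instance : AddAction (ℤ × ℤ) Config where
  vadd a ω := fun e => ω (e.shift (-a))
  zero_vadd ω := by
    funext e
    change ω (e.shift (-0)) = ω e
    cases e <;> simp [Edge.shift]
  add_vadd a b ω := by
    funext e
    change ω (e.shift (-(a + b))) = ω ((e.shift (-a)).shift (-b))
    cases e <;> simp [Edge.shift] <;> congr 1 <;> congr 1 <;> ring

theorem vadd_apply (a : ℤ × ℤ) (ω : Config) (e : Edge) : (a +ᵥ ω) e = ω (e.shift (-a)) := rfl

/-- The `σ`-algebra generated by the states of all edges other than `e`. -/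
abbrev sigmaOff (e : Edge) : MeasurableSpace Config :=
  MeasurableSpace.comap (fun (ω : Config) (f : {f : Edge // f ≠ e}) => ω f) inferInstance

/-- (Uniform) finite energy: for some `δ > 0` and every edge `e`, the conditional probability that
`e` is open given the states of all other edges lies almost surely in `[δ, 1 - δ]`. -/
def HasFiniteEnergy (μ : Measure Config) : Prop :=
  ∃ δ : ℝ, 0 < δ ∧ ∀ e : Edge, ∀ᵐ ω ∂μ,
    (μ[Set.indicator {ω' : Config | ω' e = true} (fun _ => (1 : ℝ)) | sigmaOff e]) ω
      ∈ Set.Icc δ (1 - δ)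

/-! Planar duality. The plaquette centred at `(x + 1/2, y + 1/2)` is identified with `(x, y)`. -/

/-- The edge of the square lattice crossed by a given edge of the dual lattice. The dual edge from
plaquette `(x, y)` to plaquette `(x + 1, y)` crosses the edge from `(x + 1, y)` to
`(x + 1, y + 1)`; the dual edge from plaquette `(x, y)` to plaquette `(x, y + 1)` crosses the edge
from `(x, y + 1)` to `(x + 1, y + 1)`. -/
def Edge.crossed : Edge → Edge
  | .horizontal x y => .vertical (x + 1) y
  | .vertical x y => .horizontal x (y + 1)

/-- The dual configuration: a dual edge is open if and only if the edge that it crosses is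
closed. -/
def dualConfig (ω : Config) : Config := fun e => !(ω e.crossed)

/-- The dual measure `μ*`. -/
noncomputable def dualMeasure (μ : Measure Config) : Measure Config := μ.map dualConfig

/-- The vertices of the upper half-plane `ℤ × ℤ_{≥ 0}`. -/
abbrev HalfPlane : Type := {v : ℤ × ℤ // 0 ≤ v.2}

/-- The edges of the upper half-plane: those with both endpoints in it. -/
abbrev HalfPlaneEdge : Type := {e : Edge // ∀ v ∈ e.ends, 0 ≤ v.2}

/-- Configurations on the upper half-plane. -/
abbrev HalfPlaneConfig : Type := HalfPlaneEdge → Bool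

/-- Restriction of a configuration to the upper half-plane. -/
def restrictHalfPlane (ω : Config) : HalfPlaneConfig := fun e => ω e.1

/-- The marginal `μ_hp` of `μ` on the upper half-plane. -/
noncomputable def halfPlaneMarginal (μ : Measure Config) : Measure HalfPlaneConfig :=
  μ.map restrictHalfPlane

theorem measurable_dualConfig : Measurable dualConfig :=
  measurable_pi_lambda _ fun e =>
    (measurable_of_countable (fun b : Bool => !b)).comp (measurable_pi_apply e.crossed)

theorem measurable_restrictHalfPlane : Measurable restrictHalfPlane :=
  measurable_pi_lambda _ fun e => measurable_pi_apply e.1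

/-- The subgraph of the upper half-plane formed by all its vertices and the open edges. -/
def openGraph (η : HalfPlaneConfig) : SimpleGraph HalfPlane :=
  SimpleGraph.fromEdgeSet
    {p | ∃ e : HalfPlaneEdge, η e = true ∧ e.1.ends = p.map Subtype.val}

/-- There is exactly one infinite cluster (connected component of the open subgraph). -/
def HasUniqueInfiniteCluster (η : HalfPlaneConfig) : Prop :=
  ∃! C : (openGraph η).ConnectedComponent, C.supp.Infinite

/-- There is no infinite cluster. -/
def HasNoInfiniteCluster (η : HalfPlaneConfig) : Prop :=
  ¬ ∃ C : (openGraph η).ConnectedComponent, C.supp.Infinite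

end Percolation

open Percolation

/-! The heart of the matter is that infinite primal and dual clusters cannot coexist in the
half-plane. A stationary random subset of `ℤ` has no extremal point, since the events "n is
extremal" are disjoint and equiprobable. With finite energy this forces an infinite dual cluster to
come down to the boundary line, and then to do so arbitrarily far to the left and to the right
(`ae_exists_infAt_boundary_open_below`, `ae_boundaryBounded`). By planarity
(`not_infAt_dual_of_joined`) no primal cluster passes over such a point, so primal clusters meet the
boundary line in bounded sets.

Bounded traces rule out infinite clusters by counting. Represent an infinite cluster touching the
line by its leftmost boundary point. Every such cluster of `{y ≥ -1}` contains one of `{y ≥ 0}`, and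
vertical invariance gives both levels the same intensity, so by mass transport every infinite
cluster of `{y ≥ 0}` touching its line is joined to height `-1`
(`ae_exists_joined_below_of_isLeftEnd`). But closing the finitely many edges beneath one such
cluster, which finite energy allows, would cut it off: a contradiction.

Two further facts finish the proof. Existence of an infinite cluster obeys a zero-one law
(`ae_exists_infAt_or_ae_forall_not`), and two distinct infinite clusters are separated by an
infinite dual one (`exists_infAt_dual_of_not_joined`), so absence of dual infinite clusters gives
uniqueness. -/

namespace Percolation

/-! ### Open paths and infinite clusters in half-planes -/

/-- The open edges of `ω` within the half-plane `{y ≥ k}`, as a graph on `ℤ × ℤ`. -/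
def halfGraph (ω : Config) (k : ℤ) : SimpleGraph (ℤ × ℤ) where
  Adj u v := k ≤ u.2 ∧ k ≤ v.2 ∧ ∃ e : Edge, ω e = true ∧ e.ends = s(u, v)
  symm := ⟨fun u v h => ⟨h.2.1, h.1, by simpa only [Sym2.eq_swap] using h.2.2⟩⟩
  loopless := ⟨by
    rintro ⟨a, b⟩ ⟨-, -, e, -, he⟩
    cases e <;> simp [Edge.ends] at he <;> omega⟩

/-- `u` and `v` are joined by an open path within `{y ≥ k}`. -/
def Joined (ω : Config) (k : ℤ) (u v : ℤ × ℤ) : Prop := (halfGraph ω k).Reachable u v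

/-- The cluster of `u` within the half-plane `{y ≥ k}` is infinite. -/
def InfAt (ω : Config) (k : ℤ) (u : ℤ × ℤ) : Prop := {v | Joined ω k u v}.Infinite

theorem Joined.refl (ω : Config) (k : ℤ) (u : ℤ × ℤ) : Joined ω k u u :=
  SimpleGraph.Reachable.refl u

theorem Joined.symm {ω : Config} {k : ℤ} {u v : ℤ × ℤ} (h : Joined ω k u v) :
    Joined ω k v u := SimpleGraph.Reachable.symm h

theorem Joined.trans {ω : Config} {k : ℤ} {u v w : ℤ × ℤ} (h : Joined ω k u v)
    (h' : Joined ω k v w) : Joined ω k u w := SimpleGraph.Reachable.trans h h'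

theorem Joined.of_adj {ω : Config} {k : ℤ} {u v : ℤ × ℤ} (h : (halfGraph ω k).Adj u v) :
    Joined ω k u v := SimpleGraph.Adj.reachable h

/-- Induction along an open path, extending at its end. -/
theorem Joined.induction {ω : Config} {k : ℤ} {u v : ℤ × ℤ} (h : Joined ω k u v)
    {P : ℤ × ℤ → Prop} (h0 : P u)
    (hs : ∀ v w, Joined ω k u v → (halfGraph ω k).Adj v w → P v → P w) : P v := by
  have h1 := (SimpleGraph.reachable_iff_reflTransGen u v).1 h
  induction h1 with
  | refl => exact h0
  | tail hab hbc ih =>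
    have := (SimpleGraph.reachable_iff_reflTransGen _ _).2 hab
    exact hs _ _ this hbc (ih this)

/-- Adjacency spelled out. -/
theorem halfGraph_adj_cases {ω : Config} {k : ℤ} {a b c d : ℤ}
    (h : (halfGraph ω k).Adj (a, b) (c, d)) : k ≤ b ∧ k ≤ d ∧
      ((ω (.horizontal a b) = true ∧ c = a + 1 ∧ d = b) ∨
       (ω (.horizontal c b) = true ∧ a = c + 1 ∧ d = b) ∨
       (ω (.vertical a b) = true ∧ c = a ∧ d = b + 1) ∨
       (ω (.vertical a d) = true ∧ c = a ∧ b = d + 1)) := by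
  obtain ⟨h1, h2, e, he, hv⟩ := h
  refine ⟨h1, h2, ?_⟩
  cases e with
  | horizontal x y =>
    simp only [Edge.ends, Sym2.eq_iff, Prod.mk.injEq] at hv
    obtain ⟨⟨rfl, rfl⟩, h3, h4⟩ | ⟨⟨rfl, rfl⟩, h3, rfl⟩ := hv
    · exact Or.inl ⟨he, h3.symm, h4.symm⟩
    · exact Or.inr (Or.inl ⟨he, h3.symm, rfl⟩)
  | vertical x y =>
    simp only [Edge.ends, Sym2.eq_iff, Prod.mk.injEq] at hv
    obtain ⟨⟨rfl, rfl⟩, h3, h4⟩ | ⟨⟨rfl, rfl⟩, rfl, h4⟩ := hv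
    · exact Or.inr (Or.inr (Or.inl ⟨he, h3.symm, h4.symm⟩))
    · exact Or.inr (Or.inr (Or.inr ⟨he, rfl, h4.symm⟩))

theorem halfGraph_adj_horizontal {ω : Config} {k x y : ℤ} (hy : k ≤ y)
    (h : ω (.horizontal x y) = true) : (halfGraph ω k).Adj (x, y) (x + 1, y) :=
  ⟨hy, hy, _, h, rfl⟩

theorem halfGraph_adj_vertical {ω : Config} {k x y : ℤ} (hy : k ≤ y)
    (h : ω (.vertical x y) = true) : (halfGraph ω k).Adj (x, y) (x, y + 1) :=
  ⟨hy, by simp; omega, _, h, rfl⟩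

/-- An open path between distinct vertices stays in the half-plane. -/
theorem Joined.eq_or_le {ω : Config} {k : ℤ} {u v : ℤ × ℤ} (h : Joined ω k u v) :
    u = v ∨ (k ≤ u.2 ∧ k ≤ v.2) := by
  refine h.induction (P := fun v => u = v ∨ (k ≤ u.2 ∧ k ≤ v.2)) (Or.inl rfl) ?_
  · intro v w _ hvw ih
    rcases ih with rfl | ih
    · exact Or.inr ⟨hvw.1, hvw.2.1⟩
    · exact Or.inr ⟨ih.1, hvw.2.1⟩

theorem Joined.le {ω : Config} {k : ℤ} {u v : ℤ × ℤ} (h : Joined ω k u v) (hu : k ≤ u.2) :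
    k ≤ v.2 := by
  rcases h.eq_or_le with rfl | h
  · exact hu
  · exact h.2

theorem InfAt.le {ω : Config} {k : ℤ} {u : ℤ × ℤ} (h : InfAt ω k u) : k ≤ u.2 := by
  by_contra hu
  refine h ((Set.finite_singleton u).subset fun v hv => ?_)
  rcases Joined.eq_or_le hv with rfl | h
  · rfl
  · exact absurd h.1 hu

theorem Joined.mono {ω : Config} {k l : ℤ} (hkl : k ≤ l) {u v : ℤ × ℤ} (h : Joined ω l u v) :
    Joined ω k u v :=
  SimpleGraph.Reachable.mono
    (show halfGraph ω l ≤ halfGraph ω k from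
      fun _ _ h => ⟨hkl.trans h.1, hkl.trans h.2.1, h.2.2⟩) h

theorem InfAt.mono {ω : Config} {k l : ℤ} (hkl : k ≤ l) {u : ℤ × ℤ} (h : InfAt ω l u) :
    InfAt ω k u := Set.Infinite.mono (fun _ => Joined.mono hkl) h

theorem InfAt.of_joined {ω : Config} {k : ℤ} {u v : ℤ × ℤ} (h : InfAt ω k u)
    (huv : Joined ω k u v) : InfAt ω k v :=
  Set.Infinite.mono (fun _ hw => huv.symm.trans hw) h

/-- Configurations that agree on the edges of the half-plane have the same paths. -/
theorem Joined.congr {ω ω' : Config} {k : ℤ}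
    (h : ∀ e : Edge, (∀ v ∈ e.ends, k ≤ v.2) → ω e = ω' e) {u v : ℤ × ℤ} :
    Joined ω k u v ↔ Joined ω' k u v := by
  have : halfGraph ω k = halfGraph ω' k := by
    ext u v
    refine and_congr_right fun hu => and_congr_right fun hv => exists_congr fun e =>
      and_congr_left fun he => ?_
    rw [h e]
    rw [he]
    intro w hw
    rcases Sym2.mem_iff.1 hw with rfl | rfl <;> assumption
  rw [Joined, Joined, this]

theorem InfAt.congr {ω ω' : Config} {k : ℤ}
    (h : ∀ e : Edge, (∀ v ∈ e.ends, k ≤ v.2) → ω e = ω' e) {u : ℤ × ℤ} :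
    InfAt ω k u ↔ InfAt ω' k u := by
  simp only [InfAt, Joined.congr h]

theorem Edge.shift_shift (a b : ℤ × ℤ) (e : Edge) : (e.shift a).shift b = e.shift (a + b) := by
  cases e <;> simp [Edge.shift, add_assoc]

theorem Edge.shift_zero (e : Edge) : e.shift 0 = e := by
  cases e <;> simp [Edge.shift]

theorem Edge.ends_shift (a : ℤ × ℤ) (e : Edge) : (e.shift a).ends = e.ends.map (· + a) := by
  cases e <;> simp [Edge.shift, Edge.ends, Prod.ext_iff, add_right_comm]

theorem Joined.vadd {ω : Config} {k : ℤ} {u v : ℤ × ℤ} (a : ℤ × ℤ) (h : Joined ω k u v) :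
    Joined (a +ᵥ ω) (k + a.2) (u + a) (v + a) := by
  refine SimpleGraph.Reachable.map (G' := halfGraph (a +ᵥ ω) (k + a.2)) ⟨(· + a), ?_⟩ h
  rintro p q ⟨h1, h2, e, he, hpq⟩
  refine ⟨by simpa using h1, by simpa using h2, e.shift a, ?_, ?_⟩
  · rw [vadd_apply, Edge.shift_shift]; simpa [Edge.shift_zero] using he
  · rw [Edge.ends_shift, hpq]; rfl

theorem joined_vadd {ω : Config} {k : ℤ} {u v : ℤ × ℤ} (a : ℤ × ℤ) :
    Joined (a +ᵥ ω) k u v ↔ Joined ω (k - a.2) (u - a) (v - a) := by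
  constructor
  · intro h
    have := h.vadd (-a)
    simpa [← sub_eq_add_neg] using this
  · intro h
    have := h.vadd a
    simpa using this

theorem InfAt.vadd {ω : Config} {k : ℤ} {u : ℤ × ℤ} (a : ℤ × ℤ) (h : InfAt ω k u) :
    InfAt (a +ᵥ ω) (k + a.2) (u + a) := by
  refine (Set.Infinite.image (f := (· + a)) (add_left_injective a).injOn h).mono ?_
  rintro _ ⟨v, hv, rfl⟩
  exact Joined.vadd a hv

theorem infAt_vadd {ω : Config} {k : ℤ} {u : ℤ × ℤ} (a : ℤ × ℤ) :
    InfAt (a +ᵥ ω) k u ↔ InfAt ω (k - a.2) (u - a) := by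
  constructor
  · intro h
    have := h.vadd (-a)
    simpa [← sub_eq_add_neg] using this
  · intro h
    have := h.vadd a
    simpa using this

/-! ### Measurability of connection events -/

instance : Countable Edge := by
  refine Function.Injective.countable (f := fun e : Edge => e.ends) fun e f h => ?_
  exact Edge.bijOn_ends.injOn trivial trivial h

theorem measurableSet_open (e : Edge) : MeasurableSet {ω : Config | ω e = true} :=
  measurableSet_eq_fun (measurable_pi_apply e) measurable_const

theorem measurableSet_closed (e : Edge) : MeasurableSet {ω : Config | ω e = false} :=
  measurableSet_eq_fun (measurable_pi_apply e) measurable_const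

theorem measurableSet_adj (k : ℤ) (u v : ℤ × ℤ) :
    MeasurableSet {ω : Config | (halfGraph ω k).Adj u v} := by
  refine (MeasurableSet.const _).inter ((MeasurableSet.const _).inter ?_)
  change MeasurableSet {ω : Config | ∃ e : Edge, ω e = true ∧ e.ends = s(u, v)}
  rw [Set.ofPred_exists]
  exact MeasurableSet.iUnion fun e => (measurableSet_open e).inter (MeasurableSet.const _)

theorem measurableSet_joined (k : ℤ) (u v : ℤ × ℤ) :
    MeasurableSet {ω : Config | Joined ω k u v} := by
  have key : ∀ (n : ℕ) (u : ℤ × ℤ),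
      MeasurableSet {ω : Config | ∃ p : (halfGraph ω k).Walk u v, p.length = n} := by
    intro n
    induction n with
    | zero =>
      intro u
      have : {ω : Config | ∃ p : (halfGraph ω k).Walk u v, p.length = 0} = {_ω | u = v} := by
        ext ω
        simp
      rw [this]
      exact MeasurableSet.const _
    | succ n ih =>
      intro u
      have : {ω : Config | ∃ p : (halfGraph ω k).Walk u v, p.length = n + 1} =
          ⋃ w, {ω | (halfGraph ω k).Adj u w} ∩
            {ω | ∃ p : (halfGraph ω k).Walk w v, p.length = n} := by
        ext ω
        simp only [Set.mem_ofPred_eq, Set.mem_iUnion, Set.mem_inter_iff]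
        constructor
        · rintro ⟨p, hp⟩
          cases p with
          | nil => simp at hp
          | cons h q => exact ⟨_, h, q, by simpa using hp⟩
        · rintro ⟨w, h, q, hq⟩
          exact ⟨.cons h q, by simpa using hq⟩
      rw [this]
      exact MeasurableSet.iUnion fun w => (measurableSet_adj k u w).inter (ih w)
  have : {ω : Config | Joined ω k u v} =
      ⋃ n, {ω : Config | ∃ p : (halfGraph ω k).Walk u v, p.length = n} := by
    ext ω
    simp only [Set.mem_ofPred_eq, Set.mem_iUnion]
    exact ⟨fun ⟨p⟩ => ⟨_, p, rfl⟩, fun ⟨_, p, _⟩ => ⟨p⟩⟩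
  rw [this]
  exact MeasurableSet.iUnion fun n => key n u

theorem measurableSet_infAt (k : ℤ) (u : ℤ × ℤ) : MeasurableSet {ω : Config | InfAt ω k u} := by
  have : {ω : Config | InfAt ω k u} =
      ⋂ s : Finset (ℤ × ℤ), ⋃ v, {ω | v ∉ s} ∩ {ω | Joined ω k u v} := by
    ext ω
    simp only [Set.mem_ofPred_eq, Set.mem_iInter, Set.mem_iUnion, Set.mem_inter_iff]
    constructor
    · intro h s
      obtain ⟨v, hv, hs⟩ := Set.Infinite.exists_notMem_finset h s
      exact ⟨v, hs, hv⟩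
    · intro h hfin
      obtain ⟨v, hv, hj⟩ := h hfin.toFinset
      exact hv (by simpa using hj)
  rw [this]
  exact MeasurableSet.iInter fun s => MeasurableSet.iUnion fun v =>
    (MeasurableSet.const _).inter (measurableSet_joined k u v)

/-! ### Finite energy and local modifications -/

/-- Setting the state of any single edge preserves null sets. -/
def FlipTolerant (ν : Measure Config) : Prop :=
  ∀ (e : Edge) (b : Bool), Measure.QuasiMeasurePreserving
    (fun ω : Config => (open Classical in Function.update ω e b)) ν ν

open Classical in
theorem measurable_update_edge (e : Edge) (b : Bool) :
    Measurable (fun ω : Config => Function.update ω e b) := by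
  refine measurable_pi_lambda _ fun f => ?_
  by_cases h : f = e
  · subst h; simp
  · simpa [Function.update_of_ne h] using measurable_pi_apply f

open Classical in
-- Updating at `e` forgets the old state of `e`, so the update factors through the states of the
-- other edges.
theorem measurableSet_sigmaOff_preimage_update (e : Edge) (b : Bool) {A : Set Config}
    (hA : MeasurableSet A) :
    MeasurableSet[sigmaOff e] ((fun ω : Config => Function.update ω e b) ⁻¹' A) := by
  let g : ({f : Edge // f ≠ e} → Bool) → Config :=
    fun η f => if h : f = e then b else η ⟨f, h⟩
  have hg : Measurable g := by
    refine measurable_pi_lambda _ fun f => ?_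
    by_cases h : f = e
    · simp [g, h]
    · simpa [g, h] using measurable_pi_apply (⟨f, h⟩ : {f : Edge // f ≠ e})
  refine ⟨g ⁻¹' A, hg hA, ?_⟩
  have : (fun ω : Config => Function.update ω e b) =
      g ∘ fun (ω : Config) (f : {f : Edge // f ≠ e}) => ω f := by
    funext ω f
    by_cases h : f = e
    · subst h; simp [g]
    · simp [g, h]
  rw [this]; rfl

/-- The preimage `B` of a null set under the update does not depend on the state of `e`, so given
`B` both states of `e` have probability at least `δ`. Where `e` already has state `b` the update
does nothing, so that part of `B` is null; hence `B` is null. -/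
theorem HasFiniteEnergy.flipTolerant {μ : Measure Config} [IsProbabilityMeasure μ]
    (h : HasFiniteEnergy μ) : FlipTolerant μ := by
  classical
  obtain ⟨δ, hδ, h⟩ := h
  intro e b
  have hm := measurable_update_edge e b
  refine ⟨by convert hm, Measure.AbsolutelyContinuous.mk fun A hA hA0 => ?_⟩
  rw [Measure.map_apply (by convert hm) hA]
  have hle : sigmaOff e ≤ (inferInstance : MeasurableSpace Config) := by
    rintro _ ⟨s, hs, rfl⟩
    exact (measurable_pi_lambda _ fun f => measurable_pi_apply f.1) hs
  set B : Set Config := (fun ω : Config => Function.update ω e b) ⁻¹' A with hB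
  have hBs : MeasurableSet[sigmaOff e] B := measurableSet_sigmaOff_preimage_update e b hA
  have hBb : μ (B ∩ {ω | ω e = b}) = 0 := by
    refine measure_mono_null ?_ hA0
    rintro ω ⟨h1, h2⟩
    have h3 : Function.update ω e b = ω := by
      rw [← (show ω e = b from h2)]; exact Function.update_eq_self e ω
    have h4 : Function.update ω e b ∈ A := h1
    rwa [h3] at h4
  have hO := measurableSet_open e
  have hint : Integrable (Set.indicator {ω' : Config | ω' e = true} fun _ => (1 : ℝ)) μ :=
    (integrable_const 1).indicator hO
  have hset := setIntegral_condExp hle hint hBs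
  rw [setIntegral_indicator hO, setIntegral_const, smul_eq_mul, mul_one] at hset
  -- Integrate the two bounds on the conditional probability over `B`, which belongs to `sigmaOff
  -- e`.
  have hlow : δ * μ.real B ≤ μ.real (B ∩ {ω | ω e = true}) := by
    rw [← hset, mul_comm, ← smul_eq_mul, ← setIntegral_const]
    refine setIntegral_mono_ae (integrable_const _).integrableOn integrable_condExp.integrableOn ?_
    filter_upwards [h e] with ω hω using hω.1
  have hup : μ.real (B ∩ {ω | ω e = true}) ≤ (1 - δ) * μ.real B := by
    rw [← hset, mul_comm, ← smul_eq_mul, ← setIntegral_const]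
    refine setIntegral_mono_ae integrable_condExp.integrableOn (integrable_const _).integrableOn ?_
    filter_upwards [h e] with ω hω using hω.2
  have hpos : 0 ≤ μ.real B := measureReal_nonneg
  have : μ.real B = 0 := by
    cases b with
    | true =>
      have h0 : μ.real (B ∩ {ω | ω e = true}) = 0 := by rw [measureReal_def, hBb]; rfl
      nlinarith
    | false =>
      have h0 : μ.real (B ∩ {ω | ω e = false}) = 0 := by rw [measureReal_def, hBb]; rfl
      have h1 : μ.real B ≤ μ.real (B ∩ {ω | ω e = true}) + μ.real (B ∩ {ω | ω e = false}) := by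
        refine le_trans (measureReal_mono ?_) (measureReal_union_le _ _)
        intro ω hω
        cases hb : ω e
        · exact Or.inr ⟨hω, hb⟩
        · exact Or.inl ⟨hω, hb⟩
      nlinarith
  have h2 := (measureReal_eq_zero_iff).1 this
  convert h2

open Classical in
theorem FlipTolerant.ae {ν : Measure Config} (h : FlipTolerant ν) {p : Config → Prop}
    (hp : ∀ᵐ ω ∂ν, p ω) (e : Edge) (b : Bool) : ∀ᵐ ω ∂ν, p (Function.update ω e b) := by
  have := (h e b).ae hp
  convert this

/-- The configuration obtained from `ω` by closing the edges in a finite set. -/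
noncomputable def closeEdges (s : Finset Edge) (ω : Config) : Config :=
  fun e => open Classical in if e ∈ s then false else ω e

theorem FlipTolerant.ae_closeEdges {ν : Measure Config} (h : FlipTolerant ν) {p : Config → Prop}
    (hp : ∀ᵐ ω ∂ν, p ω) (s : Finset Edge) : ∀ᵐ ω ∂ν, p (closeEdges s ω) := by
  classical
  induction s using Finset.induction_on generalizing p with
  | empty =>
    have h0 : ∀ ω, closeEdges ∅ ω = ω := fun ω => by funext f; simp [closeEdges]
    simpa [h0] using hp
  | insert e s he ih =>
    filter_upwards [ih (h.ae hp e false)] with ω hω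
    convert hω using 1
    funext f
    by_cases hf : f = e
    · subst hf; simp [closeEdges]
    · simp [closeEdges, hf]

/-- There are countably many finite edge sets, so the set to be closed may afterwards be chosen
depending on `ω`. -/
theorem FlipTolerant.ae_forall_closeEdges {ν : Measure Config} (h : FlipTolerant ν)
    {p : Config → Prop} (hp : ∀ᵐ ω ∂ν, p ω) : ∀ᵐ ω ∂ν, ∀ s, p (closeEdges s ω) :=
  ae_all_iff.2 fun s => h.ae_closeEdges hp s

/-! ### Stationary subsets of `ℤ` and mass transport -/

section Equivariant

variable {Ω : Type*} [MeasurableSpace Ω] {ν : Measure Ω} {T : Ω → Ω}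

theorem measure_eq_of_preimage_succ (hT : MeasurePreserving T ν ν) {p : ℤ → Set Ω}
    (hp : ∀ n, MeasurableSet (p n)) (hTp : ∀ n, T ⁻¹' p (n + 1) = p n) (m n : ℤ) :
    ν (p m) = ν (p n) := by
  have step : ∀ n, ν (p n) = ν (p (n + 1)) := fun n => by
    rw [← hTp n, hT.measure_preimage (hp _).nullMeasurableSet]
  have all : ∀ n, ν (p n) = ν (p 0) := by
    intro n
    induction n using Int.induction_on with
    | zero => rfl
    | succ i ih => rw [← step, ih]
    | pred i ih => rw [step, sub_add_cancel, ih]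
  rw [all m, all n]

/-- Disjoint events that are translates of one another are null. -/
theorem measure_eq_zero_of_pairwise_disjoint [IsFiniteMeasure ν] (hT : MeasurePreserving T ν ν)
    {p : ℤ → Set Ω} (hp : ∀ n, MeasurableSet (p n)) (hTp : ∀ n, T ⁻¹' p (n + 1) = p n)
    (hd : Pairwise (Function.onFun Disjoint p)) (n : ℤ) : ν (p n) = 0 := by
  by_contra h
  have h1 : ν (⋃ m, p m) = ∑' m, ν (p m) := measure_iUnion hd hp
  have h2 : ∑' m : ℤ, ν (p m) = ⊤ := by
    rw [tsum_congr fun m => measure_eq_of_preimage_succ hT hp hTp m n]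
    exact ENNReal.tsum_const_eq_top_of_ne_zero h
  exact measure_ne_top ν _ (h1.trans h2)

/-- A stationary random subset of `ℤ` almost surely has no element that is extremal for a
translation-invariant total relation. -/
theorem ae_exists_rel [IsFiniteMeasure ν] (hT : MeasurePreserving T ν ν) {p : ℤ → Set Ω}
    (hp : ∀ n, MeasurableSet (p n)) (hTp : ∀ n, T ⁻¹' p (n + 1) = p n) {r : ℤ → ℤ → Prop}
    (hr : ∀ m n, r (m + 1) (n + 1) ↔ r m n) (ht : ∀ m n, m ≠ n → r m n ∨ r n m) :
    ∀ᵐ ω ∂ν, ∀ n, ω ∈ p n → ∃ m, r n m ∧ ω ∈ p m := by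
  have key : ∀ n, ν (p n \ ⋃ m : ℤ, ⋃ _ : r n m, p m) = 0 := by
    refine measure_eq_zero_of_pairwise_disjoint hT
      (fun n => (hp n).diff (.iUnion fun m => .iUnion fun _ => hp m)) ?_ ?_
    · intro n
      rw [Set.preimage_sdiff, hTp]
      congr 1
      ext ω
      simp only [Set.mem_preimage, Set.mem_iUnion, exists_prop]
      constructor
      · rintro ⟨m, hm, h⟩
        refine ⟨m - 1, (hr _ _).1 (by simpa using hm), ?_⟩
        rw [← hTp]; simpa using h
      · rintro ⟨m, hm, h⟩
        rw [← hTp] at h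
        exact ⟨m + 1, (hr _ _).2 hm, h⟩
    · intro m n hmn
      refine Set.disjoint_left.2 fun ω h1 h2 => ?_
      rcases ht m n hmn with h | h
      · exact h1.2 (Set.mem_iUnion₂.2 ⟨n, h, h2.1⟩)
      · exact h2.2 (Set.mem_iUnion₂.2 ⟨m, h, h1.1⟩)
  refine ae_all_iff.2 fun n => ?_
  filter_upwards [measure_eq_zero_iff_ae_notMem.1 (key n)] with ω hω hn
  by_contra hc
  refine hω ⟨hn, fun h => hc ?_⟩
  obtain ⟨m, hm, h⟩ := Set.mem_iUnion₂.1 h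
  exact ⟨m, hm, h⟩

/-- A stationary random subset of `ℤ` almost surely has no greatest element. -/
theorem ae_exists_gt [IsFiniteMeasure ν] (hT : MeasurePreserving T ν ν) {p : ℤ → Set Ω}
    (hp : ∀ n, MeasurableSet (p n)) (hTp : ∀ n, T ⁻¹' p (n + 1) = p n) :
    ∀ᵐ ω ∂ν, ∀ n, ω ∈ p n → ∃ m, n < m ∧ ω ∈ p m :=
  ae_exists_rel hT hp hTp (by simp) fun _ _ => lt_or_gt_of_ne

/-- A stationary random subset of `ℤ` almost surely has no least element. -/
theorem ae_exists_lt [IsFiniteMeasure ν] (hT : MeasurePreserving T ν ν) {p : ℤ → Set Ω}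
    (hp : ∀ n, MeasurableSet (p n)) (hTp : ∀ n, T ⁻¹' p (n + 1) = p n) :
    ∀ᵐ ω ∂ν, ∀ n, ω ∈ p n → ∃ m, m < n ∧ ω ∈ p m :=
  ae_exists_rel hT hp hTp (r := fun m n => n < m) (by simp) fun _ _ h => (lt_or_gt_of_ne h).symm

/-- A stationary random injection from a stationary random subset `X'` of `ℤ` into another one `X`
of the same intensity is almost surely onto. -/
theorem ae_surjective_of_intensity_eq [IsFiniteMeasure ν] (hT : MeasurePreserving T ν ν)
    {X X' : ℤ → Set Ω} {R : ℤ → ℤ → Set Ω} (hRm : ∀ x y, MeasurableSet (R x y))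
    (hRT : ∀ x y, T ⁻¹' R (x + 1) (y + 1) = R x y)
    (hRX : ∀ x y, R x y ⊆ X y) (hX'R : ∀ x, ∀ᵐ ω ∂ν, ω ∈ X' x → ∃ y, ω ∈ R x y)
    (hRf : ∀ ω x y y', ω ∈ R x y → ω ∈ R x y' → y = y')
    (hRi : ∀ ω x x' y, ω ∈ R x y → ω ∈ R x' y → x = x')
    (hXX' : ∀ y, ν (X y) = ν (X' y)) :
    ∀ᵐ ω ∂ν, ∀ y, ω ∈ X y → ∃ x, ω ∈ R x y := by
  refine ae_all_iff.2 fun z => ?_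
  have h1 : ν (X' z) ≤ ν (⋃ y, R z y) := by
    refine measure_mono_ae ?_
    filter_upwards [hX'R z] with ω hω h
    exact Set.mem_iUnion.2 (hω h)
  have h2 : ν (⋃ y, R z y) = ∑' y, ν (R z y) :=
    measure_iUnion (fun y y' hyy' => Set.disjoint_left.2 fun ω h h' => hyy' (hRf ω z y y' h h'))
      (hRm z)
  have h3 : ν (⋃ x, R x z) = ∑' x, ν (R x z) :=
    measure_iUnion (fun x x' hxx' => Set.disjoint_left.2 fun ω h h' => hxx' (hRi ω x x' z h h'))
      (fun x => hRm x z)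
  -- Mass transport: the diagonal shift by `z - y` turns mass sent from `z` into mass received at
  -- `z`.
  have h4 : ∀ y, ν (R z y) = ν (R (2 * z - y) z) := by
    intro y
    have := measure_eq_of_preimage_succ hT (p := fun n => R (z + n) (y + n))
      (fun n => hRm _ _) (fun n => by simpa [add_assoc] using hRT (z + n) (y + n)) 0 (z - y)
    simpa [two_mul, add_sub_assoc] using this
  have h5 : ∑' y, ν (R z y) = ∑' x, ν (R x z) := by
    rw [tsum_congr h4]
    exact (Equiv.subLeft (2 * z)).tsum_eq fun x => ν (R x z)
  have h6 : ν (X z) ≤ ν (⋃ x, R x z) := by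
    rw [hXX', h3, ← h5, ← h2]; exact h1
  have h7 : (⋃ x, R x z : Set Ω) =ᵐ[ν] X z :=
    ae_eq_of_subset_of_measure_ge (Set.iUnion_subset fun x => hRX x z) h6
      (MeasurableSet.iUnion fun x => hRm x z).nullMeasurableSet (measure_ne_top _ _)
  filter_upwards [h7.mem_iff] with ω hω h
  exact Set.mem_iUnion.1 (hω.2 h)

end Equivariant

/-! ### Winding numbers: primal paths enclose dual clusters -/

/-- A flow of winding numbers around an open path from `u` to `v`: `N p` counts the signed crossings
of the path with the upward ray from the plaquette `p`. -/
theorem Joined.exists_winding {ω : Config} {u v : ℤ × ℤ} (h : Joined ω 0 u v) :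
    ∃ N : ℤ → ℤ → ℤ, {p : ℤ × ℤ | 0 ≤ p.2 ∧ N p.1 p.2 ≠ 0}.Finite ∧
      (∀ x y, ω (.horizontal x (y + 1)) = false → N x (y + 1) = N x y) ∧
      (∀ x y, ω (.vertical (x + 1) y) = false → N x y - N (x + 1) y =
        (if v.1 = x + 1 ∧ y < v.2 then 1 else 0) - (if u.1 = x + 1 ∧ y < u.2 then 1 else 0)) ∧
      (∀ x, N x (-1) = (if u.1 ≤ x then 1 else 0) - (if v.1 ≤ x then 1 else 0)) := by
  refine h.induction (P := fun v => ∃ N : ℤ → ℤ → ℤ,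
      {p : ℤ × ℤ | 0 ≤ p.2 ∧ N p.1 p.2 ≠ 0}.Finite ∧
      (∀ x y, ω (.horizontal x (y + 1)) = false → N x (y + 1) = N x y) ∧
      (∀ x y, ω (.vertical (x + 1) y) = false → N x y - N (x + 1) y =
        (if v.1 = x + 1 ∧ y < v.2 then 1 else 0) - (if u.1 = x + 1 ∧ y < u.2 then 1 else 0)) ∧
      (∀ x, N x (-1) = (if u.1 ≤ x then 1 else 0) - (if v.1 ≤ x then 1 else 0))) ?_ ?_
  · exact ⟨fun _ _ => 0, by simp, by simp, by simp, by simp⟩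
  · rintro ⟨a, b⟩ ⟨c, d⟩ - hadj ⟨N, hfin, hh, hv, hb⟩
    obtain ⟨hb0, hd0, hcase⟩ := halfGraph_adj_cases hadj
    have hfin' : ∀ M : ℤ → ℤ → ℤ, (∀ x y, M x y ≠ N x y → (x = a ∨ x = c) ∧ y < b) →
        {p : ℤ × ℤ | 0 ≤ p.2 ∧ M p.1 p.2 ≠ 0}.Finite := by
      intro M hM
      refine (hfin.union ((Set.toFinite {a, c}).prod (Set.finite_Ico (0 : ℤ) b))).subset ?_
      rintro ⟨x, y⟩ ⟨hy, hne⟩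
      by_cases h0 : N x y = 0
      · right
        have := hM x y (by simpa [h0] using hne)
        exact ⟨by simpa using this.1, hy, this.2⟩
      · exact Or.inl ⟨hy, h0⟩
    rcases hcase with ⟨ho, rfl, rfl⟩ | ⟨ho, rfl, rfl⟩ | ⟨ho, rfl, rfl⟩ | ⟨ho, rfl, rfl⟩
    -- A rightward edge at height `d` crosses exactly the rays from the plaquettes `(a, y)` with `y
    -- < d`, their centres being at height `y + 1/2`.
    · refine ⟨fun x y => N x y + if x = a ∧ y < d then 1 else 0, ?_, ?_, ?_, ?_⟩
      · refine hfin' (fun x y => N x y + if x = a ∧ y < d then 1 else 0) fun x y h => ?_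
        by_cases h1 : x = a ∧ y < d
        · exact ⟨Or.inl h1.1, h1.2⟩
        · exact absurd (by simp [h1]) h
      · intro x y hc
        have hne : ¬ (x = a ∧ y + 1 = d) := by
          rintro ⟨rfl, rfl⟩; simp [hc] at ho
        have := hh x y hc
        simp only
        split_ifs <;> omega
      · intro x y hc
        have := hv x y hc
        simp only at this ⊢
        split_ifs at this ⊢ <;> omega
      · intro x
        have := hb x
        simp only at this ⊢
        split_ifs at this ⊢ <;> omega
    · refine ⟨fun x y => N x y + if x = c ∧ y < d then -1 else 0, ?_, ?_, ?_, ?_⟩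
      · refine hfin' (fun x y => N x y + if x = c ∧ y < d then -1 else 0) fun x y h => ?_
        by_cases h1 : x = c ∧ y < d
        · exact ⟨Or.inr h1.1, h1.2⟩
        · exact absurd (by simp [h1]) h
      · intro x y hc
        have hne : ¬ (x = c ∧ y + 1 = d) := by
          rintro ⟨rfl, rfl⟩; simp [hc] at ho
        have := hh x y hc
        simp only
        split_ifs <;> omega
      · intro x y hc
        have := hv x y hc
        simp only at this ⊢
        split_ifs at this ⊢ <;> omega
      · intro x
        have := hb x
        simp only at this ⊢
        split_ifs at this ⊢ <;> omega
    -- A vertical edge crosses no vertical ray. Moving the endpoint alters the correction term only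
    -- across this very edge, which is open and hence exempt.
    · refine ⟨N, hfin, hh, ?_, hb⟩
      intro x y hc
      have hne : ¬ (x + 1 = c ∧ y = b) := by
        rintro ⟨rfl, rfl⟩; simp [hc] at ho
      have := hv x y hc
      simp only at this ⊢
      split_ifs at this ⊢ <;> omega
    · refine ⟨N, hfin, hh, ?_, hb⟩
      intro x y hc
      have hne : ¬ (x + 1 = c ∧ y = d) := by
        rintro ⟨rfl, rfl⟩; simp [hc] at ho
      have := hv x y hc
      simp only at this ⊢
      split_ifs at this ⊢ <;> omega

theorem dualConfig_horizontal {ω : Config} {x y : ℤ} :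
    dualConfig ω (.horizontal x y) = true ↔ ω (.vertical (x + 1) y) = false := by
  simp [dualConfig, Edge.crossed]

theorem dualConfig_vertical {ω : Config} {x y : ℤ} :
    dualConfig ω (.vertical x y) = true ↔ ω (.horizontal x (y + 1)) = false := by
  simp [dualConfig, Edge.crossed]

/-- An open path between two points of the boundary line encloses the dual clusters beneath it. -/
theorem not_infAt_dual_of_joined {ω : Config} {x₁ x₂ x : ℤ} (h : Joined ω 0 (x₁, 0) (x₂, 0))
    (h₁ : x₁ ≤ x) (h₂ : x < x₂) (hx : ω (.horizontal x 0) = false) :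
    ¬ InfAt (dualConfig ω) 0 (x, 0) := by
  obtain ⟨N, hfin, hh, hv, hb⟩ := h.exists_winding
  -- From plaquette `(x, -1)`, below the line, the ray sees the net crossing from `x₁ ≤ x` to `x₂ >
  -- x`; the closed edge above that plaquette carries the value up to `(x, 0)`.
  have h0 : N x 0 = 1 := by
    have h1 := hh x (-1) (by simpa using hx)
    have h2 := hb x
    simp only [neg_add_cancel] at h1 h2
    rw [if_pos h₁, if_neg (by omega)] at h2
    omega
  refine fun hinf => hinf (hfin.subset ?_)
  intro p hp
  refine Joined.induction hp (P := fun p => 0 ≤ p.2 ∧ N p.1 p.2 ≠ 0) ⟨le_rfl, by simp [h0]⟩ ?_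
  rintro ⟨a, b⟩ ⟨c, d⟩ - hadj ⟨-, hN⟩
  obtain ⟨hb0, hd0, hcase⟩ := halfGraph_adj_cases hadj
  refine ⟨hd0, ?_⟩
  simp only [dualConfig_horizontal, dualConfig_vertical] at hcase hN ⊢
  -- Both endpoints of the primal path have height `0`, so no correction arises and `N` is constant
  -- along open dual paths.
  rcases hcase with ⟨ho, rfl, rfl⟩ | ⟨ho, rfl, rfl⟩ | ⟨ho, rfl, rfl⟩ | ⟨ho, rfl, rfl⟩
  · have := hv _ _ ho
    simp only [show ¬ d < 0 by omega, and_false, if_false] at this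
    omega
  · have := hv _ _ ho
    simp only [show ¬ d < 0 by omega, and_false, if_false] at this
    omega
  · rw [hh _ _ ho]; exact hN
  · rw [← hh _ _ ho]; exact hN

/-! ### Distinct infinite clusters are separated by a dual cluster -/

theorem exists_forall_add_one_sub (a : ℤ → ℤ) : ∃ F : ℤ → ℤ, ∀ x, F (x + 1) - F x = a x := by
  refine ⟨fun x => ∑ i ∈ Finset.range x.toNat, a i -
    ∑ i ∈ Finset.range (-x).toNat, a (-(i : ℤ) - 1), fun x => ?_⟩
  rcases lt_or_ge x 0 with hx | hx
  · obtain ⟨n, rfl⟩ : ∃ n : ℕ, x = -(n : ℤ) - 1 := ⟨(-x - 1).toNat, by omega⟩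
    have h1 : (-(-(n : ℤ) - 1 + 1)).toNat = n := by omega
    have h2 : (-(-(n : ℤ) - 1)).toNat = n + 1 := by omega
    have h3 : (-(n : ℤ) - 1 + 1).toNat = 0 := by omega
    have h4 : (-(n : ℤ) - 1).toNat = 0 := by omega
    simp only [h1, h2, h3, h4, Finset.sum_range_succ, Finset.range_zero, Finset.sum_empty]
    ring
  · obtain ⟨n, rfl⟩ : ∃ n : ℕ, x = n := ⟨x.toNat, by omega⟩
    have h1 : ((n : ℤ) + 1).toNat = n + 1 := by omega
    have h2 : (-((n : ℤ) + 1)).toNat = 0 := by omega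
    have h3 : (-(n : ℤ)).toNat = 0 := by omega
    simp only [h1, h2, h3, Int.toNat_natCast, Finset.sum_range_succ, Finset.range_zero,
      Finset.sum_empty]
    ring

/-- A closed flow on the edges of the half-plane is the gradient of a potential. -/
theorem exists_potential (sh sv : ℤ → ℤ → ℤ)
    (hc : ∀ x y, 0 ≤ y → sh x y + sv (x + 1) y = sv x y + sh x (y + 1)) :
    ∃ f : ℤ → ℤ → ℤ, (∀ x y, 0 ≤ y → f (x + 1) y - f x y = sh x y) ∧
      (∀ x y, f x (y + 1) - f x y = sv x y) := by
  obtain ⟨F, hF⟩ := exists_forall_add_one_sub fun x => sh x 0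
  choose V hV using fun x => exists_forall_add_one_sub (sv x)
  refine ⟨fun x y => F x + (V x y - V x 0), fun x y hy => ?_, fun x y => ?_⟩
  · induction y, hy using Int.leInduction with
    | base => have := hF x; simp only at this ⊢; omega
    | succ y hy ih =>
      have h1 := hV x y
      have h2 := hV (x + 1) y
      have h3 := hc x y hy
      simp only at ih ⊢
      omega
  · have h1 := hV x y
    simp only
    omega

/-- The half-plane minus a finite box is connected. -/
theorem iff_of_outside_box {P : ℤ → ℤ → Prop} {m : ℤ} (hm : 0 ≤ m)
    (hh : ∀ x y, 0 ≤ y → m < y → (P x y ↔ P (x + 1) y))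
    (hv : ∀ x y, 0 ≤ y → (m < |x| ∨ m < y) → (P x y ↔ P x (y + 1))) {x y : ℤ} (hy : 0 ≤ y)
    (hxy : m < |x| ∨ m < y) : P x y ↔ P (m + 1) (m + 1) := by
  have hline : ∀ y, m < y → ∀ x, P x y ↔ P 0 y := by
    intro y hy x
    induction x using Int.induction_on with
    | zero => rfl
    | succ i ih => rw [← hh _ _ (by omega) hy, ih]
    | pred i ih => rw [hh _ _ (by omega) hy, sub_add_cancel, ih]
  have hup : ∀ x y, 0 ≤ y → (m < |x| ∨ m < y) → ∀ z, y ≤ z → (P x y ↔ P x z) := by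
    intro x y hy hxy z hz
    induction z, hz using Int.leInduction with
    | base => rfl
    | succ z hz ih => rw [ih, hv x z (by omega) (by omega)]
  have hM : P x y ↔ P x (max y (m + 1)) := hup x y hy hxy _ (le_max_left _ _)
  have hM' : P (m + 1) (m + 1) ↔ P (m + 1) (max y (m + 1)) :=
    hup _ _ (by omega) (Or.inr (by omega)) _ (le_max_right _ _)
  rw [hM, hM', hline _ (by omega), hline _ (by omega) (m + 1)]

/-- Two distinct infinite clusters of the half-plane are separated by an infinite dual cluster. -/
theorem exists_infAt_dual_of_not_joined {ω : Config} {u v : ℤ × ℤ} (hu : InfAt ω 0 u)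
    (hv : InfAt ω 0 v) (huv : ¬ Joined ω 0 u v) : ∃ p, InfAt (dualConfig ω) 0 p := by
  classical
  have hu0 := hu.le
  have hv0 := hv.le
  -- the component `U` of `v` in the complement of the cluster of `u`
  let F : SimpleGraph (ℤ × ℤ) :=
    { Adj := fun p q => (halfGraph (fun _ => true) 0).Adj p q ∧ ¬ Joined ω 0 u p ∧ ¬ Joined ω 0 u q
      symm := ⟨fun p q h => ⟨h.1.symm, h.2.2, h.2.1⟩⟩
      loopless := ⟨fun p h => h.1.ne rfl⟩ }
  let U : ℤ → ℤ → Prop := fun x y => F.Reachable v (x, y)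
  have hUind : ∀ {P : ℤ → ℤ → Prop}, P v.1 v.2 →
      (∀ a b c d, U a b → F.Adj (a, b) (c, d) → P a b → P c d) → ∀ {x y}, U x y → P x y := by
    intro P h0 hs x y h
    have h1 := (SimpleGraph.reachable_iff_reflTransGen v (x, y)).1 h
    have : ∀ w, Relation.ReflTransGen F.Adj v w → P w.1 w.2 := by
      intro w hw
      induction hw with
      | refl => exact h0
      | tail hab hbc ih =>
        exact hs _ _ _ _ ((SimpleGraph.reachable_iff_reflTransGen _ _).2 hab) hbc ih
    exact this _ h1
  have hUC : ∀ {x y}, U x y → ¬ Joined ω 0 u (x, y) := fun {x y} h =>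
    hUind (P := fun x y => ¬ Joined ω 0 u (x, y)) huv (fun _ _ _ _ _ h _ => h.2.2) h
  have hUh : ∀ {x y}, U x y → 0 ≤ y := fun {x y} h =>
    hUind (P := fun x y => 0 ≤ y) hv0 (fun _ _ _ _ _ h _ => h.1.2.1) h
  have hUv : ∀ {p}, Joined ω 0 v p → U p.1 p.2 := by
    intro p hp
    refine (SimpleGraph.reachable_iff_reflTransGen _ _).2 ?_
    refine hp.induction (P := fun p => Relation.ReflTransGen F.Adj v p) .refl ?_
    intro a b hva hab ih
    refine ih.tail ⟨⟨hab.1, hab.2.1, ?_⟩, ?_, ?_⟩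
    · obtain ⟨e, -, he⟩ := hab.2.2
      exact ⟨e, rfl, he⟩
    · exact fun h => huv (h.trans hva.symm)
    · exact fun h => huv (h.trans (hva.trans (.of_adj hab)).symm)
  have hFstep : ∀ {a b c d : ℤ}, (halfGraph (fun _ => true) 0).Adj (a, b) (c, d) → U a b →
      ¬ U c d → Joined ω 0 u (c, d) := by
    intro a b c d hadj h1 h2
    by_contra h3
    exact h2 (h1.trans (SimpleGraph.Adj.reachable (G := F) ⟨hadj, hUC h1, h3⟩))
  have hAh : ∀ {x y : ℤ}, 0 ≤ y → (halfGraph (fun _ => true) 0).Adj (x, y) (x + 1, y) :=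
    fun hy => halfGraph_adj_horizontal hy rfl
  have hAv : ∀ {x y : ℤ}, 0 ≤ y → (halfGraph (fun _ => true) 0).Adj (x, y) (x, y + 1) :=
    fun hy => halfGraph_adj_vertical hy rfl
  -- boundary edges of `U` are closed
  have hclosed_h : ∀ {x y : ℤ}, 0 ≤ y → ¬ (U x y ↔ U (x + 1) y) →
      ω (.horizontal x y) = false := by
    intro x y hy hne
    by_contra ho
    have hj := Joined.of_adj (halfGraph_adj_horizontal hy (by simpa using ho))
    by_cases h1 : U x y
    · have h2 := hFstep (hAh hy) h1 (by tauto)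
      exact hUC h1 (h2.trans hj.symm)
    · have h2 := hFstep (hAh hy).symm (by tauto) h1
      exact hUC (by tauto : U (x + 1) y) (h2.trans hj)
  have hclosed_v : ∀ {x y : ℤ}, 0 ≤ y → ¬ (U x y ↔ U x (y + 1)) →
      ω (.vertical x y) = false := by
    intro x y hy hne
    by_contra ho
    have hj := Joined.of_adj (halfGraph_adj_vertical hy (by simpa using ho))
    by_cases h1 : U x y
    · have h2 := hFstep (hAv hy) h1 (by tauto)
      exact hUC h1 (h2.trans hj.symm)
    · have h2 := hFstep (hAv hy).symm (by tauto) h1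
      exact hUC (by tauto : U x (y + 1)) (h2.trans hj)
  -- `U` and its complement both reach outside every box
  have hout : ∀ m : ℤ, ∀ {w : ℤ × ℤ}, InfAt ω 0 w →
      ∃ x y, Joined ω 0 w (x, y) ∧ 0 ≤ y ∧ (m < |x| ∨ m < y) := by
    intro m w hw
    by_contra! hcon
    refine hw (((Set.finite_Icc (-m) m).prod (Set.finite_Icc 0 m)).subset ?_)
    rintro ⟨x, y⟩ hxy
    have hy : 0 ≤ y := Joined.le hxy hw.le
    have := hcon x y hxy hy
    exact ⟨abs_le.1 this.1, hy, this.2⟩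
  -- Otherwise membership in `U` would be constant outside a box, yet the cluster of `v` lies in
  -- `U`, that of `u` misses it, and both leave the box.
  have hbd : ∀ m : ℤ, ∃ x y, 0 ≤ y ∧ ((¬ (U x y ↔ U (x + 1) y) ∧ m < y) ∨
      (¬ (U x y ↔ U x (y + 1)) ∧ (m < |x| ∨ m < y))) := by
    intro m
    by_contra! hcon
    obtain ⟨x, y, hj, hy, hxy⟩ := hout (max m 0) hu
    obtain ⟨x', y', hj', hy', hxy'⟩ := hout (max m 0) hv
    have key : ∀ {x y : ℤ}, 0 ≤ y → (max m 0 < |x| ∨ max m 0 < y) →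
        (U x y ↔ U (max m 0 + 1) (max m 0 + 1)) := by
      intro x y hy hxy
      refine iff_of_outside_box (le_max_right _ _) ?_ ?_ hy hxy
      · intro x y hy h
        by_contra hne
        have := (hcon x y hy).1 (by tauto)
        omega
      · intro x y hy h
        by_contra hne
        have := (hcon x y hy).2 (by tauto)
        omega
    exact hUC ((key hy hxy).2 ((key hy' hxy').1 (hUv hj'))) hj
  -- the plaquettes bordering a boundary edge
  let B : ℤ × ℤ → Prop := fun p => 0 ≤ p.2 ∧ (¬ (U p.1 p.2 ↔ U (p.1 + 1) p.2) ∨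
    ¬ (U p.1 (p.2 + 1) ↔ U (p.1 + 1) (p.2 + 1)) ∨ ¬ (U p.1 p.2 ↔ U p.1 (p.2 + 1)) ∨
    ¬ (U (p.1 + 1) p.2 ↔ U (p.1 + 1) (p.2 + 1)))
  have hB : ∃ p, B p := by
    obtain ⟨x, y, hy, h | h⟩ := hbd 0
    · exact ⟨(x, y), hy, Or.inl h.1⟩
    · exact ⟨(x, y), hy, Or.inr (Or.inr (Or.inl h.1))⟩
  obtain ⟨p₀, hp₀, hp₀B⟩ := hB
  refine ⟨p₀, ?_⟩
  let K : ℤ → ℤ → Prop := fun x y => Joined (dualConfig ω) 0 p₀ (x, y)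
  have hKle : ∀ {x y}, K x y → 0 ≤ y := fun h => Joined.le h hp₀
  have hKh : ∀ {x y}, 0 ≤ y → ¬ (U (x + 1) y ↔ U (x + 1) (y + 1)) → (K x y ↔ K (x + 1) y) := by
    intro x y hy hne
    have hj := Joined.of_adj (halfGraph_adj_horizontal (ω := dualConfig ω) hy
      (dualConfig_horizontal.2 (hclosed_v hy hne)))
    exact ⟨fun h => h.trans hj, fun h => h.trans hj.symm⟩
  have hKv : ∀ {x y}, 0 ≤ y → ¬ (U x (y + 1) ↔ U (x + 1) (y + 1)) →
      (K x y ↔ K x (y + 1)) := by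
    intro x y hy hne
    have hj := Joined.of_adj (halfGraph_adj_vertical (ω := dualConfig ω) hy
      (dualConfig_vertical.2 (hclosed_h (by omega) hne)))
    exact ⟨fun h => h.trans hj, fun h => h.trans hj.symm⟩
  -- the gradient of the indicator of `U`, restricted to the edges bordering `K`
  let g : ℤ → ℤ → ℤ := fun x y => if U x y then 1 else 0
  let sh : ℤ → ℤ → ℤ := fun x y => if K x y ∨ K x (y - 1) then g (x + 1) y - g x y else 0
  let sv : ℤ → ℤ → ℤ := fun x y => if K x y ∨ K (x - 1) y then g x (y + 1) - g x y else 0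
  have hg : ∀ {x y x' y'}, (U x y ↔ U x' y') → g x y = g x' y' := fun h => by simp only [g, h]
  -- Closedness around each plaquette: in `K`, all four sides carry the full gradient of `g`.
  -- Outside `K`, a side with nonzero flow would be a boundary edge of `U` bordering `K`, and the
  -- open dual edge crossing it would bring the plaquette into `K`.
  obtain ⟨f, hfh, hfv⟩ := exists_potential sh sv (by
    intro x y hy
    by_cases hK : K x y
    · simp only [sh, sv, hK, true_or, or_true, if_true, add_sub_cancel_right]
      ring
    · have h1 : sh x y = 0 := by
        simp only [sh]
        split_ifs with h
        · by_contra hne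
          have hKy : K x (y - 1) := h.resolve_left hK
          have := hKv (x := x) (y := y - 1) (hKle hKy)
            (by rw [sub_add_cancel]; exact fun h => hne (sub_eq_zero.2 (hg h).symm))
          rw [sub_add_cancel] at this
          exact hK (this.1 hKy)
        · rfl
      have h2 : sv (x + 1) y = 0 := by
        simp only [sv, add_sub_cancel_right]
        split_ifs with h
        · by_contra hne
          exact hK ((hKh hy fun h => hne (sub_eq_zero.2 (hg h).symm)).2 (h.resolve_right hK))
        · rfl
      have h3 : sv x y = 0 := by
        simp only [sv]
        split_ifs with h
        · by_contra hne
          have hKy : K (x - 1) y := h.resolve_left hK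
          have := hKh (x := x - 1) (y := y) hy
            (by rw [sub_add_cancel]; exact fun h => hne (sub_eq_zero.2 (hg h).symm))
          rw [sub_add_cancel] at this
          exact hK (this.1 hKy)
        · rfl
      have h4 : sh x (y + 1) = 0 := by
        simp only [sh, add_sub_cancel_right]
        split_ifs with h
        · by_contra hne
          exact hK ((hKv hy fun h => hne (sub_eq_zero.2 (hg h).symm)).2 (h.resolve_right hK))
        · rfl
      rw [h1, h2, h3, h4])
  have hfadj : ∀ {a b c d : ℤ}, (halfGraph (fun _ => true) 0).Adj (a, b) (c, d) →
      (U a b ↔ U c d) → f c d = f a b := by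
    intro a b c d hadj h
    have hgh := hg h
    obtain ⟨hb0, hd0, hcase⟩ := halfGraph_adj_cases hadj
    rcases hcase with ⟨ho, rfl, rfl⟩ | ⟨ho, rfl, rfl⟩ | ⟨ho, rfl, rfl⟩ | ⟨ho, rfl, rfl⟩
    · have := hfh a d hd0
      simp only [sh, hgh, sub_self, ite_self] at this
      omega
    · have := hfh c d hd0
      simp only [sh, hgh, sub_self, ite_self] at this
      omega
    · have := hfv c b
      simp only [sv, hgh, sub_self, ite_self] at this
      omega
    · have := hfv c d
      simp only [sv, hgh, sub_self, ite_self] at this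
      omega
  have hfC : ∀ {x y}, Joined ω 0 u (x, y) → f x y = f u.1 u.2 := by
    intro x y h
    refine h.induction (P := fun p => f p.1 p.2 = f u.1 u.2) rfl ?_
    rintro ⟨a, b⟩ ⟨c, d⟩ h1 hadj ih
    refine (hfadj ⟨hadj.1, hadj.2.1, ?_⟩ ?_).trans ih
    · obtain ⟨e, -, he⟩ := hadj.2.2
      exact ⟨e, rfl, he⟩
    · exact iff_of_false (fun h => hUC h h1) (fun h => hUC h (h1.trans (.of_adj hadj)))
  have hfU : ∀ {x y}, U x y → f x y = f v.1 v.2 := by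
    intro x y h
    refine hUind (P := fun x y => f x y = f v.1 v.2) rfl ?_ h
    intro a b c d h1 hadj ih
    exact (hfadj hadj.1 (iff_of_true h1 (h1.trans hadj.reachable))).trans ih
  -- A boundary edge of `U` joins `U` to the cluster of `u`, and `f` is constant on each; so all
  -- these edges share one jump of `f`, up to sign.
  have hfne : ∀ {a b c d : ℤ}, (halfGraph (fun _ => true) 0).Adj (a, b) (c, d) →
      ¬ (U a b ↔ U c d) → |f c d - f a b| = |f v.1 v.2 - f u.1 u.2| ∧ |g c d - g a b| = 1 := by
    intro a b c d hadj hne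
    by_cases h : U a b
    · have h2 : ¬ U c d := by tauto
      rw [hfU h, hfC (hFstep hadj h h2)]
      exact ⟨abs_sub_comm _ _, by simp [g, h, h2]⟩
    · have h2 : U c d := by tauto
      rw [hfU h2, hfC (hFstep hadj.symm h2 h)]
      exact ⟨rfl, by simp [g, h, h2]⟩
  -- A boundary edge beside `p₀` borders `K`, so there `f` jumps by `±1`.
  have hjump : f v.1 v.2 - f u.1 u.2 ≠ 0 := by
    have hKp : K p₀.1 p₀.2 := Joined.refl _ _ _
    intro h0
    rw [h0, abs_zero] at hfne
    rcases hp₀B with h | h | h | h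
    · obtain ⟨h1, h2⟩ := hfne (hAh hp₀) h
      rw [hfh _ _ hp₀] at h1
      simp only [sh, hKp, true_or, if_true] at h1
      omega
    · obtain ⟨h1, h2⟩ := hfne (hAh (by omega)) h
      rw [hfh _ _ (by omega)] at h1
      simp only [sh, add_sub_cancel_right, hKp, or_true, if_true] at h1
      omega
    · obtain ⟨h1, h2⟩ := hfne (hAv hp₀) h
      rw [hfv] at h1
      simp only [sv, hKp, true_or, if_true] at h1
      omega
    · obtain ⟨h1, h2⟩ := hfne (hAv hp₀) h
      rw [hfv] at h1
      simp only [sv, add_sub_cancel_right, hKp, or_true, if_true] at h1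
      omega
  -- hence `K` borders every boundary edge
  have hKall_h : ∀ {x y}, 0 ≤ y → ¬ (U x y ↔ U (x + 1) y) → K x y ∨ K x (y - 1) := by
    intro x y hy hne
    by_contra hK
    have h1 := (hfne (hAh hy) hne).1
    rw [hfh _ _ hy] at h1
    simp only [sh, hK, if_false, abs_zero] at h1
    exact hjump (abs_eq_zero.1 h1.symm)
  have hKall_v : ∀ {x y}, 0 ≤ y → ¬ (U x y ↔ U x (y + 1)) → K x y ∨ K (x - 1) y := by
    intro x y hy hne
    by_contra hK
    have h1 := (hfne (hAv hy) hne).1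
    rw [hfv] at h1
    simp only [sv, hK, if_false, abs_zero] at h1
    exact hjump (abs_eq_zero.1 h1.symm)
  intro hfin
  obtain ⟨M, hM⟩ : ∃ M : ℤ, ∀ x y, K x y → |x| ≤ M ∧ y ≤ M := by
    obtain ⟨M₁, h₁⟩ := (hfin.image fun p => |p.1|).bddAbove
    obtain ⟨M₂, h₂⟩ := (hfin.image fun p => p.2).bddAbove
    exact ⟨max M₁ M₂, fun x y h => ⟨(h₁ ⟨(x, y), h, rfl⟩).trans (le_max_left _ _),
      (h₂ ⟨(x, y), h, rfl⟩).trans (le_max_right _ _)⟩⟩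
  obtain ⟨x, y, hy, ⟨h, hm⟩ | ⟨h, hm⟩⟩ := hbd (M + 1)
  · rcases hKall_h hy h with hK | hK
    · have := hM _ _ hK; omega
    · have := hM _ _ hK; omega
  · rcases hKall_v hy h with hK | hK
    · have := hM _ _ hK; omega
    · have h1 := hM _ _ hK
      have h2 : |x| ≤ |x - 1| + 1 := by
        have := abs_add_le (x - 1) 1
        simpa using this
      omega

/-! ### Descent to the boundary line and the zero-one law -/

theorem measurable_vadd_config (a : ℤ × ℤ) : Measurable fun ω : Config => a +ᵥ ω :=
  measurable_pi_lambda _ fun e => measurable_pi_apply (e.shift (-a))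

theorem infAt_vadd_right {ω : Config} {k x : ℤ} {y : ℤ} :
    InfAt (((1 : ℤ), (0 : ℤ)) +ᵥ ω) k (x + 1, y) ↔ InfAt ω k (x, y) := by
  simp [infAt_vadd]

theorem joined_vadd_right {ω : Config} {k x y x' y' : ℤ} :
    Joined (((1 : ℤ), (0 : ℤ)) +ᵥ ω) k (x + 1, y) (x' + 1, y') ↔ Joined ω k (x, y) (x', y') := by
  simp [joined_vadd]

theorem joined_vadd_up {ω : Config} {k x y x' y' : ℤ} :
    Joined (((0 : ℤ), (1 : ℤ)) +ᵥ ω) k (x, y) (x', y') ↔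
      Joined ω (k - 1) (x, y - 1) (x', y' - 1) := by
  simp [joined_vadd]

theorem infAt_vadd_up {ω : Config} {k x y : ℤ} :
    InfAt (((0 : ℤ), (1 : ℤ)) +ᵥ ω) k (x, y) ↔ InfAt ω (k - 1) (x, y - 1) := by
  simp [infAt_vadd]

/-- Take `l` to be the lowest height that the cluster reaches: all its paths then stay in `{y ≥ l}`.
-/
theorem InfAt.exists_boundary {ω : Config} {k : ℤ} {v : ℤ × ℤ} (h : InfAt ω k v) :
    ∃ l x, k ≤ l ∧ InfAt ω l (x, l) := by
  obtain ⟨l, ⟨w, hw, rfl⟩, hmin⟩ := Int.exists_least_of_bdd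
    (P := fun l => ∃ w, Joined ω k v w ∧ w.2 = l)
    ⟨k, by rintro _ ⟨w, hw, rfl⟩; exact hw.le h.le⟩ ⟨_, v, Joined.refl _ _ _, rfl⟩
  have hj : ∀ {z}, Joined ω k v z → Joined ω w.2 v z := by
    intro z hz
    refine hz.induction (P := fun z => Joined ω w.2 v z) (Joined.refl _ _ _) ?_
    intro a b ha hab ih
    exact ih.trans (.of_adj ⟨hmin _ ⟨a, ha, rfl⟩, hmin _ ⟨b, ha.trans (.of_adj hab), rfl⟩, hab.2.2⟩)
  refine ⟨w.2, w.1, hw.le h.le, ?_⟩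
  exact InfAt.of_joined (Set.Infinite.mono (fun z hz => hj hz) h) (hj hw)

section Stationary

variable {ν : Measure Config} [IsProbabilityMeasure ν]
  (hinv : ∀ a : ℤ × ℤ, MeasurePreserving (fun ω : Config => a +ᵥ ω) ν ν)

include hinv in
-- Open the edge below `(x, k)` by force. The points with the desired property form a stationary
-- set, which has no greatest element, so there is another one to the right of `x`, and this one was
-- there before the modification.
theorem ae_exists_infAt_open_below (hft : FlipTolerant ν) :
    ∀ᵐ ω ∂ν, ∀ k x, InfAt ω k (x, k) →
      ∃ x', InfAt ω k (x', k) ∧ ω (.vertical x' (k - 1)) = true := by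
  classical
  refine ae_all_iff.2 fun k => ae_all_iff.2 fun x => ?_
  have h := ae_exists_gt (hinv (1, 0))
    (p := fun n => {ω | InfAt ω k (n, k)} ∩ {ω | ω (.vertical n (k - 1)) = true})
    (fun n => (measurableSet_infAt k _).inter (measurableSet_open _)) (by
      intro n
      ext ω
      simp only [Set.mem_preimage, Set.mem_inter_iff, Set.mem_ofPred_eq, infAt_vadd_right,
        vadd_apply, Edge.shift]
      simp)
  filter_upwards [hft.ae h (.vertical x (k - 1)) true] with ω hω hx
  have hcongr : ∀ u, InfAt (Function.update ω (.vertical x (k - 1)) true) k u ↔ InfAt ω k u := by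
    refine fun u => InfAt.congr fun e he => Function.update_of_ne ?_ _ _
    rintro rfl
    have := he (x, k - 1) (by simp [Edge.ends])
    simp at this
  obtain ⟨m, hm, h1, h2⟩ := hω x ⟨(hcongr _).2 hx, by simp⟩
  refine ⟨m, (hcongr _).1 h1, ?_⟩
  have h3 : Function.update ω (.vertical x (k - 1)) true (.vertical m (k - 1)) = true := h2
  rwa [Function.update_of_ne (by simp; omega)] at h3

include hinv in
theorem ae_exists_infAt_boundary_open_below (hft : FlipTolerant ν) :
    ∀ᵐ ω ∂ν, ∀ k v, InfAt ω k v →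
      ∃ x, InfAt ω k (x, k) ∧ ω (.vertical x (k - 1)) = true := by
  filter_upwards [ae_exists_infAt_open_below hinv hft] with ω hω k v hv
  obtain ⟨l, x, hkl, hx⟩ := hv.exists_boundary
  -- Descend one level at a time from `l` to `k` through the open edges below.
  have : ∃ x, InfAt ω k (x, k) := by
    revert x
    induction l, hkl using Int.leInduction with
    | base => exact fun x hx => ⟨x, hx⟩
    | succ l hl ih =>
      intro x hx
      obtain ⟨x', h1, h2⟩ := hω _ x hx
      rw [add_sub_cancel_right] at h2
      exact ih x' ((h1.mono (by omega)).of_joined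
        (Joined.of_adj (halfGraph_adj_vertical le_rfl h2)).symm)
  obtain ⟨x, hx⟩ := this
  exact hω k x hx

theorem measurableSet_exists_infAt (k : ℤ) :
    MeasurableSet {ω : Config | ∃ v, InfAt ω k v} := by
  rw [Set.ofPred_exists]
  exact MeasurableSet.iUnion fun v => measurableSet_infAt k v

include hinv in
/-- Zero-one law for the existence of an infinite cluster in the half-plane. -/
theorem ae_exists_infAt_or_ae_forall_not
    (herg : ∀ s : Set Config, MeasurableSet s →
      (∀ a : ℤ × ℤ, (fun ω : Config => a +ᵥ ω) ⁻¹' s = s) →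
      (∀ᵐ ω ∂ν, ω ∈ s) ∨ ∀ᵐ ω ∂ν, ω ∉ s) :
    (∀ᵐ ω ∂ν, ∃ v, InfAt ω 0 v) ∨ ∀ᵐ ω ∂ν, ¬ ∃ v, InfAt ω 0 v := by
  have hiff : ∀ (a : ℤ × ℤ) (ω : Config) (k : ℤ),
      (∃ v, InfAt (a +ᵥ ω) k v) ↔ ∃ v, InfAt ω (k - a.2) v := by
    intro a ω k
    constructor
    · rintro ⟨v, hv⟩
      exact ⟨_, (infAt_vadd a).1 hv⟩
    · rintro ⟨v, hv⟩
      exact ⟨v + a, (infAt_vadd a).2 (by simpa using hv)⟩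
  rcases herg (⋃ k : ℤ, {ω | ∃ v, InfAt ω k v})
    (MeasurableSet.iUnion measurableSet_exists_infAt) (by
      intro a
      ext ω
      simp only [Set.mem_preimage, Set.mem_iUnion, Set.mem_ofPred_eq, hiff]
      exact (Equiv.subRight a.2).exists_congr_left.trans (by simp)) with h | h
  · left
    -- The set of levels with an infinite cluster has no greatest element, so some such level is at
    -- least `0`; its cluster persists in the larger half-plane `{y ≥ 0}`.
    have hgt := ae_exists_gt (hinv (0, 1)) (p := fun k => {ω | ∃ v, InfAt ω k v})
      measurableSet_exists_infAt (by
        intro n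
        ext ω
        simp only [Set.mem_preimage, Set.mem_ofPred_eq, hiff, add_sub_cancel_right])
    filter_upwards [h, hgt] with ω h1 h2
    obtain ⟨k, hk⟩ := Set.mem_iUnion.1 h1
    have : ∀ n : ℕ, ∃ m, k + n ≤ m ∧ ∃ v, InfAt ω m v := by
      intro n
      induction n with
      | zero => exact ⟨k, by simp, hk⟩
      | succ n ih =>
        obtain ⟨m, hm, h3⟩ := ih
        obtain ⟨m', hm', h4⟩ := h2 m h3
        exact ⟨m', by push_cast; omega, h4⟩
    obtain ⟨m, hm, v, hv⟩ := this (-k).toNat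
    exact ⟨v, hv.mono (by omega)⟩
  · right
    filter_upwards [h] with ω h1 h2
    exact h1 (Set.mem_iUnion.2 ⟨0, h2⟩)

/-! ### Bounded boundary traces exclude infinite clusters -/

/-- `(x, k)` is the leftmost boundary point of an infinite cluster of `{y ≥ k}`. -/
def IsLeftEnd (ω : Config) (k x : ℤ) : Prop :=
  InfAt ω k (x, k) ∧ ∀ z, Joined ω k (x, k) (z, k) → x ≤ z

/-- All clusters of `{y ≥ k}` meet the boundary line in bounded sets. -/
def BoundaryBounded (ω : Config) (k : ℤ) : Prop :=
  ∀ y, ∃ l r, ∀ z, Joined ω k (y, k) (z, k) → l ≤ z ∧ z ≤ r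

theorem BoundaryBounded.exists_isLeftEnd {ω : Config} {k x : ℤ} (h : BoundaryBounded ω k)
    (hx : InfAt ω k (x, k)) : ∃ y, IsLeftEnd ω k y ∧ Joined ω k (x, k) (y, k) := by
  obtain ⟨l, r, hlr⟩ := h x
  obtain ⟨y, hy, hmin⟩ := Int.exists_least_of_bdd (P := fun y => Joined ω k (x, k) (y, k))
    ⟨l, fun z hz => (hlr z hz).1⟩ ⟨x, Joined.refl _ _ _⟩
  exact ⟨y, ⟨hx.of_joined hy, fun z hz => hmin z (hy.trans hz)⟩, hy⟩

/-- An infinite cluster of `{y ≥ k - 1}` that meets the boundary line in a finite set contains an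
infinite cluster of `{y ≥ k}` that meets the boundary line of `{y ≥ k}`. -/
theorem BoundaryBounded.exists_infAt_above {ω : Config} {k x : ℤ}
    (h : BoundaryBounded ω (k - 1)) (hx : InfAt ω (k - 1) (x, k - 1)) :
    ∃ z, InfAt ω k (z, k) ∧ Joined ω (k - 1) (x, k - 1) (z, k) := by
  obtain ⟨l, r, hlr⟩ := h x
  by_contra! hcon
  have hfin : ∀ z, Joined ω (k - 1) (x, k - 1) (z, k) → {w | Joined ω k (z, k) w}.Finite :=
    fun z hz => by_contra fun h => hcon z h hz
  -- A vertex off the bottom line is joined within `{y ≥ k}` to the point `(z, k)` where a path to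
  -- it last leaves that line, and `l ≤ z ≤ r`. Were all these upper clusters finite, the whole
  -- cluster would be.
  refine hx ((((Set.finite_Icc l r).prod (Set.finite_singleton (k - 1))).union
    ((Set.finite_Icc l r).biUnion (t := fun z => {w | Joined ω (k - 1) (x, k - 1) (z, k) ∧
      Joined ω k (z, k) w}) fun z _ => ?_)).subset ?_)
  · by_cases hz : Joined ω (k - 1) (x, k - 1) (z, k)
    · exact (hfin z hz).subset fun w hw => hw.2
    · exact Set.finite_empty.subset fun w hw => hz hw.1
  · intro w hw
    have key : (w.2 = k - 1) ∨ ∃ z, l ≤ z ∧ z ≤ r ∧ Joined ω (k - 1) (x, k - 1) (z, k) ∧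
        Joined ω k (z, k) w := by
      refine Joined.induction hw (P := fun w => (w.2 = k - 1) ∨ ∃ z, l ≤ z ∧ z ≤ r ∧
        Joined ω (k - 1) (x, k - 1) (z, k) ∧ Joined ω k (z, k) w) (Or.inl rfl) ?_
      rintro ⟨a, b⟩ ⟨c, d⟩ hab hadj ih
      have hle := hadj.2.1
      by_cases hd : d = k - 1
      · exact Or.inl hd
      right
      rcases ih with rfl | ⟨z, h1, h2, h3, h4⟩
      · obtain ⟨h5, h6⟩ := hlr a hab
        have hac : c = a ∧ d = k := by
          obtain ⟨-, -, hcase⟩ := halfGraph_adj_cases hadj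
          simp only at hle
          omega
        obtain ⟨rfl, rfl⟩ := hac
        exact ⟨c, h5, h6, hab.trans (.of_adj hadj), Joined.refl _ _ _⟩
      · refine ⟨z, h1, h2, h3, h4.trans (.of_adj ⟨h4.le le_rfl, ?_, hadj.2.2⟩)⟩
        simp only at hle ⊢
        omega
    rcases key with h1 | ⟨z, h1, h2, h3, h4⟩
    · left
      obtain ⟨a, b⟩ := w
      obtain rfl : b = k - 1 := h1
      exact ⟨hlr a hw, rfl⟩
    · exact Or.inr (Set.mem_iUnion₂.2 ⟨z, ⟨h1, h2⟩, h3, h4⟩)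

theorem measurableSet_isLeftEnd (k x : ℤ) : MeasurableSet {ω : Config | IsLeftEnd ω k x} := by
  have : {ω : Config | IsLeftEnd ω k x} = {ω | InfAt ω k (x, k)} ∩
      ⋂ z, ({ω | Joined ω k (x, k) (z, k)}ᶜ ∪ {_ω | x ≤ z}) := by
    ext ω
    simp only [Set.mem_ofPred_eq, Set.mem_inter_iff, Set.mem_iInter, Set.mem_union,
      Set.mem_compl_iff, IsLeftEnd, imp_iff_not_or]
  rw [this]
  exact (measurableSet_infAt _ _).inter (MeasurableSet.iInter fun z =>
    (measurableSet_joined _ _ _).compl.union (MeasurableSet.const _))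

theorem isLeftEnd_vadd_right {ω : Config} {k x : ℤ} :
    IsLeftEnd (((1 : ℤ), (0 : ℤ)) +ᵥ ω) k (x + 1) ↔ IsLeftEnd ω k x := by
  rw [IsLeftEnd, IsLeftEnd, infAt_vadd_right]
  refine and_congr_right fun _ => ⟨fun h z hz => ?_, fun h z hz => ?_⟩
  · have := h (z + 1) (joined_vadd_right.2 hz)
    omega
  · have := h (z - 1) (joined_vadd_right.1 (by simpa using hz))
    omega

theorem isLeftEnd_vadd_up {ω : Config} {k x : ℤ} :
    IsLeftEnd (((0 : ℤ), (1 : ℤ)) +ᵥ ω) k x ↔ IsLeftEnd ω (k - 1) x := by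
  simp only [IsLeftEnd, infAt_vadd_up, joined_vadd_up]

/-- The left end `x` in `{y ≥ -1}` is matched to the left end `y` in `{y ≥ 0}`: the one nearest to
it (for an enumeration of `ℤ`) within its cluster. -/
def Matched (ω : Config) (x y : ℤ) : Prop :=
  IsLeftEnd ω (-1) x ∧ IsLeftEnd ω 0 y ∧ Joined ω (-1) (x, -1) (y, 0) ∧
    ∀ z, IsLeftEnd ω 0 z → Joined ω (-1) (x, -1) (z, 0) →
      Encodable.encode (y - x) ≤ Encodable.encode (z - x)

theorem measurableSet_matched (x y : ℤ) : MeasurableSet {ω : Config | Matched ω x y} := by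
  have : {ω : Config | Matched ω x y} = {ω | IsLeftEnd ω (-1) x} ∩ ({ω | IsLeftEnd ω 0 y} ∩
      ({ω | Joined ω (-1) (x, -1) (y, 0)} ∩ ⋂ z, ({ω | IsLeftEnd ω 0 z}ᶜ ∪
        ({ω | Joined ω (-1) (x, -1) (z, 0)}ᶜ ∪
          {_ω | Encodable.encode (y - x) ≤ Encodable.encode (z - x)})))) := by
    ext ω
    simp only [Set.mem_ofPred_eq, Set.mem_inter_iff, Set.mem_iInter, Set.mem_union,
      Set.mem_compl_iff, Matched, imp_iff_not_or]
  rw [this]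
  exact (measurableSet_isLeftEnd _ _).inter ((measurableSet_isLeftEnd _ _).inter
    ((measurableSet_joined _ _ _).inter (MeasurableSet.iInter fun z =>
      (measurableSet_isLeftEnd _ _).compl.union
        ((measurableSet_joined _ _ _).compl.union (MeasurableSet.const _)))))

theorem matched_vadd_right {ω : Config} {x y : ℤ} :
    Matched (((1 : ℤ), (0 : ℤ)) +ᵥ ω) (x + 1) (y + 1) ↔ Matched ω x y := by
  rw [Matched, Matched, isLeftEnd_vadd_right, isLeftEnd_vadd_right, joined_vadd_right]
  refine and_congr_right fun _ => and_congr_right fun _ => and_congr_right fun _ =>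
    ⟨fun h z h1 h2 => ?_, fun h z h1 h2 => ?_⟩
  · simpa using h (z + 1) (isLeftEnd_vadd_right.2 h1) (joined_vadd_right.2 h2)
  · have := h (z - 1) (isLeftEnd_vadd_right.1 (by simpa using h1))
      (joined_vadd_right.1 (by simpa using h2))
    rw [add_sub_add_right_eq_sub]
    rwa [sub_sub, add_comm 1 x] at this

include hinv in
-- `Matched` injects the left ends at height `-1` into those at height `0`. The intensities agree by
-- vertical invariance, so the injection is onto.
theorem ae_exists_joined_below_of_isLeftEnd (hb : ∀ᵐ ω ∂ν, BoundaryBounded ω 0) :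
    ∀ᵐ ω ∂ν, ∀ y, IsLeftEnd ω 0 y → ∃ x, Joined ω (-1) (x, -1) (y, 0) := by
  have hb' : ∀ᵐ ω ∂ν, BoundaryBounded ω (-1) := by
    filter_upwards [(hinv (0, 1)).quasiMeasurePreserving.ae hb] with ω hω
    simpa only [BoundaryBounded, joined_vadd_up, zero_sub] using hω
  have := ae_surjective_of_intensity_eq (hinv (1, 0)) (X := fun y => {ω | IsLeftEnd ω 0 y})
    (X' := fun x => {ω | IsLeftEnd ω (-1) x}) (R := fun x y => {ω | Matched ω x y})
    measurableSet_matched (fun x y => by ext ω; exact matched_vadd_right)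
    (fun x y ω h => h.2.1) (fun x => ?_) ?_ ?_ ?_
  · filter_upwards [this] with ω hω y hy
    obtain ⟨x, hx⟩ := hω y hy
    exact ⟨x, hx.2.2.1⟩
  · filter_upwards [hb, hb'] with ω h0 h1 hx
    obtain ⟨z, hz, hxz⟩ := BoundaryBounded.exists_infAt_above (k := 0) h1 hx.1
    obtain ⟨y, hy, hzy⟩ := h0.exists_isLeftEnd hz
    let S : Set ℤ := {y | IsLeftEnd ω 0 y ∧ Joined ω (-1) (x, -1) (y, 0)}
    have hS : S.Nonempty := ⟨y, hy, hxz.trans (hzy.mono (by omega))⟩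
    let f : ℤ → ℕ := fun y => Encodable.encode (y - x)
    have hmem := Function.argminOn_mem f S hS
    exact ⟨_, hx, hmem.1, hmem.2, fun z h1 h2 => Function.argminOn_le f S ⟨h1, h2⟩⟩
  · intro ω x y y' h h'
    have h1 := h.2.2.2 y' h'.2.1 h'.2.2.1
    have h2 := h'.2.2.2 y h.2.1 h.2.2.1
    have := Encodable.encode_injective (le_antisymm h1 h2)
    omega
  -- Injectivity: two left ends matched to the same point lie in one cluster, which has only one
  -- leftmost boundary point.
  · intro ω x x' y h h'
    have hj := h.2.2.1.trans h'.2.2.1.symm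
    exact le_antisymm (h.1.2 _ hj) (h'.1.2 _ hj.symm)
  · intro y
    rw [← (hinv (0, 1)).measure_preimage (measurableSet_isLeftEnd 0 y).nullMeasurableSet]
    congr 1
    ext ω
    exact isLeftEnd_vadd_up

include hinv in
-- An infinite cluster with bounded trace can be detached from height `-1` by closing the finitely
-- many edges beneath it, although almost surely no such configuration has a detached one.
theorem ae_forall_not_infAt_of_boundaryBounded (hft : FlipTolerant ν)
    (hb : ∀ᵐ ω ∂ν, BoundaryBounded ω 0) : ∀ᵐ ω ∂ν, ¬ ∃ v, InfAt ω 0 v := by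
  classical
  filter_upwards [hb, ae_exists_infAt_boundary_open_below hinv hft,
    hft.ae_forall_closeEdges (ae_exists_joined_below_of_isLeftEnd hinv hb)] with ω h1 h2 h3
  rintro ⟨v, hv⟩
  obtain ⟨x, hx, -⟩ := h2 0 v hv
  obtain ⟨y, hy, -⟩ := h1.exists_isLeftEnd hx
  obtain ⟨l, r, hlr⟩ := h1 y
  let s : Finset Edge := (Finset.Icc l r).image fun z => Edge.vertical z (-1)
  have hcongr : ∀ e : Edge, (∀ v ∈ e.ends, 0 ≤ v.2) → closeEdges s ω e = ω e := by
    intro e he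
    refine if_neg fun hs => ?_
    obtain ⟨z, -, rfl⟩ := Finset.mem_image.1 hs
    have := he (z, -1) (by simp [Edge.ends])
    simp at this
  -- The closed edges reach below height `0`, so `y` is still a left end.
  obtain ⟨x', hx'⟩ := h3 s y
    ⟨(InfAt.congr hcongr).2 hy.1, fun z hz => hy.2 z ((Joined.congr hcongr).1 hz)⟩
  have key : Joined (closeEdges s ω) 0 (y, 0) (x', -1) := by
    refine hx'.symm.induction (P := fun w => Joined (closeEdges s ω) 0 (y, 0) w)
      (Joined.refl _ _ _) ?_
    rintro ⟨a, b⟩ ⟨c, d⟩ - hadj ih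
    have hb0 : 0 ≤ b := ih.le le_rfl
    by_cases hd : 0 ≤ d
    · exact ih.trans (.of_adj ⟨hb0, hd, hadj.2.2⟩)
    · exfalso
      obtain ⟨-, hd', hcase⟩ := halfGraph_adj_cases hadj
      obtain ⟨ho, rfl, rfl, rfl⟩ : closeEdges s ω (.vertical a d) = true ∧ c = a ∧ b = 0 ∧
          d = -1 := by
        rcases hcase with h | h | h | h
        · omega
        · omega
        · omega
        · exact ⟨h.1, h.2.1, by omega, by omega⟩
      have hc := hlr c ((Joined.congr hcongr).1 ih)
      have : Edge.vertical c (-1) ∈ s := Finset.mem_image.2 ⟨c, Finset.mem_Icc.2 hc, rfl⟩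
      simp [closeEdges, this] at ho
  have := key.le le_rfl
  simp at this

/-! ### Dual clusters as barriers, and the hypotheses under duality -/

theorem dualConfig_vadd (a : ℤ × ℤ) (ω : Config) : dualConfig (a +ᵥ ω) = a +ᵥ dualConfig ω := by
  funext e
  change (!(ω (e.crossed.shift (-a)))) = !(ω (e.shift (-a)).crossed)
  congr 2
  cases e <;> simp [Edge.crossed, Edge.shift] <;> ring

include hinv in
/-- Bi-infinitely many dual clusters separate the boundary line. -/
theorem ae_boundaryBounded
    (hd : ∀ᵐ ω ∂ν, ∃ x, InfAt (dualConfig ω) 0 (x, 0) ∧ ω (.horizontal x 0) = false) :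
    ∀ᵐ ω ∂ν, BoundaryBounded ω 0 := by
  let p : ℤ → Set Config := fun n =>
    {ω | InfAt (dualConfig ω) 0 (n, 0)} ∩ {ω | ω (.horizontal n 0) = false}
  have hp : ∀ n, MeasurableSet (p n) := fun n =>
    (measurable_dualConfig (measurableSet_infAt 0 (n, 0))).inter (measurableSet_closed _)
  have hTp : ∀ n, (fun ω : Config => ((1 : ℤ), (0 : ℤ)) +ᵥ ω) ⁻¹' p (n + 1) = p n := by
    intro n
    ext ω
    simp only [p, Set.mem_preimage, Set.mem_inter_iff, Set.mem_ofPred_eq, dualConfig_vadd,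
      infAt_vadd_right, vadd_apply, Edge.shift]
    simp
  filter_upwards [hd, ae_exists_gt (hinv (1, 0)) hp hTp, ae_exists_lt (hinv (1, 0)) hp hTp]
    with ω ⟨x, hx⟩ hgt hlt y
  have hright : ∀ n : ℕ, ∃ m, x + n ≤ m ∧ ω ∈ p m := by
    intro n
    induction n with
    | zero => exact ⟨x, by simp, hx⟩
    | succ n ih =>
      obtain ⟨m, hm, h⟩ := ih
      obtain ⟨m', hm', h'⟩ := hgt m h
      exact ⟨m', by push_cast; omega, h'⟩
  have hleft : ∀ n : ℕ, ∃ m, m ≤ x - n ∧ ω ∈ p m := by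
    intro n
    induction n with
    | zero => exact ⟨x, by simp, hx⟩
    | succ n ih =>
      obtain ⟨m, hm, h⟩ := ih
      obtain ⟨m', hm', h'⟩ := hlt m h
      exact ⟨m', by push_cast; omega, h'⟩
  -- Plaquette `n` sits between the boundary points `n` and `n + 1`, so the barriers are chosen with
  -- `y ≤ r` but `l < y`.
  obtain ⟨r, hr, hr'⟩ := hright (y - x).toNat
  obtain ⟨l, hl, hl'⟩ := hleft (x - y + 1).toNat
  refine ⟨l, r, fun z hz => ⟨?_, ?_⟩⟩
  · by_contra hzl
    exact not_infAt_dual_of_joined hz.symm (by omega) (by omega) hl'.2 hl'.1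
  · by_contra hzr
    exact not_infAt_dual_of_joined hz (by omega) (by omega) hr'.2 hr'.1

end Stationary

theorem Edge.crossed_injective : Function.Injective Edge.crossed := by
  rintro (⟨x, y⟩ | ⟨x, y⟩) (⟨x', y'⟩ | ⟨x', y'⟩) h <;> simp [Edge.crossed] at h ⊢ <;> omega

open Classical in
theorem update_dualConfig (ω : Config) (e : Edge) (b : Bool) :
    Function.update (dualConfig ω) e b = dualConfig (Function.update ω e.crossed (!b)) := by
  funext f
  by_cases h : f = e
  · subst h; simp [dualConfig]
  · simp [dualConfig, h, Edge.crossed_injective.eq_iff]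

theorem FlipTolerant.dualMeasure {μ : Measure Config} (h : FlipTolerant μ) :
    FlipTolerant (dualMeasure μ) := by
  classical
  intro e b
  have hm := measurable_update_edge e b
  have hm' := measurable_update_edge e.crossed (!b)
  have h1 := (h e.crossed (!b)).absolutelyContinuous.map measurable_dualConfig
  refine ⟨by convert hm, ?_⟩
  rw [Measure.map_map measurable_dualConfig (by convert hm')] at h1
  rw [Percolation.dualMeasure, Measure.map_map (by convert hm) measurable_dualConfig]
  convert h1 using 2
  funext ω
  simp only [Function.comp]
  convert update_dualConfig ω e b

theorem measurePreserving_dualMeasure {μ : Measure Config}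
    (hinv : ∀ a : ℤ × ℤ, MeasurePreserving (fun ω : Config => a +ᵥ ω) μ μ) (a : ℤ × ℤ) :
    MeasurePreserving (fun ω : Config => a +ᵥ ω) (dualMeasure μ) (dualMeasure μ) := by
  refine ⟨measurable_vadd_config a, ?_⟩
  rw [dualMeasure, Measure.map_map (measurable_vadd_config a) measurable_dualConfig]
  have : (fun ω : Config => a +ᵥ ω) ∘ dualConfig = dualConfig ∘ fun ω : Config => a +ᵥ ω := by
    funext ω
    exact (dualConfig_vadd a ω).symm
  rw [this, ← Measure.map_map measurable_dualConfig (measurable_vadd_config a), (hinv a).map_eq]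

/-- Labelling plaquettes by their lower left corners costs half a diagonal, incurred twice here. -/
theorem dualConfig_dualConfig (ω : Config) :
    dualConfig (dualConfig ω) = (((-1 : ℤ), (-1 : ℤ)) : ℤ × ℤ) +ᵥ ω := by
  funext e
  rw [vadd_apply]
  cases e <;> simp [dualConfig, Edge.crossed, Edge.shift]

/-- Primal and dual infinite clusters do not coexist in the half-plane. -/
theorem ae_forall_not_infAt_of_dual {μ : Measure Config} [IsProbabilityMeasure μ]
    (hinv : ∀ a : ℤ × ℤ, MeasurePreserving (fun ω : Config => a +ᵥ ω) μ μ)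
    (hft : FlipTolerant μ) (hdual : ∀ᵐ ω ∂μ, ∃ v, InfAt (dualConfig ω) 0 v) :
    ∀ᵐ ω ∂μ, ¬ ∃ v, InfAt ω 0 v := by
  refine ae_forall_not_infAt_of_boundaryBounded hinv hft (ae_boundaryBounded hinv ?_)
  have : IsProbabilityMeasure (dualMeasure μ) :=
    Measure.isProbabilityMeasure_map measurable_dualConfig.aemeasurable
  have h := ae_exists_infAt_boundary_open_below (measurePreserving_dualMeasure hinv)
    hft.dualMeasure
  filter_upwards [hdual, ae_of_ae_map measurable_dualConfig.aemeasurable h] with ω ⟨v, hv⟩ h1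
  obtain ⟨x, hx, ho⟩ := h1 0 v hv
  -- The open dual edge below plaquette `(x, 0)` crosses the boundary edge from `(x, 0)` to `(x + 1,
  -- 0)`, which is therefore closed.
  exact ⟨x, hx, by simpa using dualConfig_vertical.1 ho⟩

/-! ### Transfer to the half-plane marginals -/

theorem openGraph_adj {ω : Config} {u v : HalfPlane} :
    (openGraph (restrictHalfPlane ω)).Adj u v ↔ (halfGraph ω 0).Adj u.1 v.1 := by
  rw [openGraph, SimpleGraph.fromEdgeSet_adj]
  constructor
  · rintro ⟨⟨e, he, hends⟩, -⟩
    exact ⟨u.2, v.2, e.1, he, hends⟩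
  · intro h
    obtain ⟨e, he, hends⟩ := h.2.2
    refine ⟨⟨⟨e, ?_⟩, he, hends⟩, fun huv => h.ne (congrArg _ huv)⟩
    rw [hends]
    intro w hw
    rcases Sym2.mem_iff.1 hw with rfl | rfl
    · exact u.2
    · exact v.2

theorem openGraph_reachable {ω : Config} {u v : HalfPlane} :
    (openGraph (restrictHalfPlane ω)).Reachable u v ↔ Joined ω 0 u.1 v.1 := by
  constructor
  · intro h
    exact SimpleGraph.Reachable.map (G' := halfGraph ω 0) ⟨Subtype.val, openGraph_adj.1⟩ h
  · intro h
    have key : ∀ hw : 0 ≤ v.1.2,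
        (openGraph (restrictHalfPlane ω)).Reachable u ⟨v.1, hw⟩ := by
      refine h.induction (P := fun w => ∀ hw : 0 ≤ w.2,
        (openGraph (restrictHalfPlane ω)).Reachable u ⟨w, hw⟩)
        (fun _ => SimpleGraph.Reachable.refl u) ?_
      intro a b hua hab ih hb
      exact (ih hab.1).trans (SimpleGraph.Adj.reachable (openGraph_adj.2 hab))
    exact key v.2

theorem supp_infinite_iff {ω : Config} {u : HalfPlane} :
    ((openGraph (restrictHalfPlane ω)).connectedComponentMk u).supp.Infinite ↔ InfAt ω 0 u.1 := by
  have : {v | Joined ω 0 u.1 v} =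
      Subtype.val '' ((openGraph (restrictHalfPlane ω)).connectedComponentMk u).supp := by
    ext v
    simp only [Set.mem_ofPred_eq, Set.mem_image, SimpleGraph.ConnectedComponent.mem_supp_iff,
      SimpleGraph.ConnectedComponent.eq, openGraph_reachable]
    constructor
    · intro h
      exact ⟨⟨v, h.le u.2⟩, h.symm, rfl⟩
    · rintro ⟨w, hw, rfl⟩
      exact hw.symm
  rw [InfAt, this, Set.infinite_image_iff Subtype.val_injective.injOn]

theorem exists_supp_infinite_iff {ω : Config} :
    (∃ C : (openGraph (restrictHalfPlane ω)).ConnectedComponent, C.supp.Infinite) ↔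
      ∃ v, InfAt ω 0 v := by
  constructor
  · rintro ⟨C, hC⟩
    induction C using SimpleGraph.ConnectedComponent.ind with
    | _ u => exact ⟨u.1, supp_infinite_iff.1 hC⟩
  · rintro ⟨v, hv⟩
    exact ⟨_, supp_infinite_iff (u := ⟨v, hv.le⟩) |>.2 hv⟩

theorem hasNoInfiniteCluster_restrict {ω : Config} :
    HasNoInfiniteCluster (restrictHalfPlane ω) ↔ ¬ ∃ v, InfAt ω 0 v :=
  not_congr exists_supp_infinite_iff

theorem hasUniqueInfiniteCluster_restrict {ω : Config} :
    HasUniqueInfiniteCluster (restrictHalfPlane ω) ↔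
      (∃ v, InfAt ω 0 v) ∧ ∀ u v, InfAt ω 0 u → InfAt ω 0 v → Joined ω 0 u v := by
  have hunique : ∀ {α : Type} {P : α → Prop},
      (∃! a, P a) ↔ (∃ a, P a) ∧ ∀ a b, P a → P b → a = b :=
    ⟨fun h => ⟨h.exists, fun _ _ => h.unique⟩, fun ⟨⟨a, ha⟩, h⟩ => ⟨a, ha, fun b hb => h b a hb ha⟩⟩
  rw [HasUniqueInfiniteCluster, hunique, exists_supp_infinite_iff]
  refine and_congr_right fun _ => ⟨fun h u v hu hv => ?_, fun h C D hC hD => ?_⟩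
  · have := h _ _ (supp_infinite_iff (u := ⟨u, hu.le⟩) |>.2 hu)
      (supp_infinite_iff (u := ⟨v, hv.le⟩) |>.2 hv)
    exact openGraph_reachable.1 (SimpleGraph.ConnectedComponent.eq.1 this)
  · induction C using SimpleGraph.ConnectedComponent.ind with
    | _ u =>
      induction D using SimpleGraph.ConnectedComponent.ind with
      | _ v =>
        exact SimpleGraph.ConnectedComponent.eq.2 (openGraph_reachable.2
          (h u.1 v.1 (supp_infinite_iff.1 hC) (supp_infinite_iff.1 hD)))

/-- Extension of a half-plane configuration by closed edges. -/
noncomputable def extendHalfPlane (η : HalfPlaneConfig) : Config :=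
  fun e => open Classical in if h : ∀ v ∈ e.ends, 0 ≤ v.2 then η ⟨e, h⟩ else false

theorem measurable_extendHalfPlane : Measurable extendHalfPlane := by
  refine measurable_pi_lambda _ fun e => ?_
  by_cases h : ∀ v ∈ e.ends, 0 ≤ v.2
  · simpa only [extendHalfPlane, dif_pos h] using
      measurable_pi_apply (⟨e, h⟩ : HalfPlaneEdge)
  · simp only [extendHalfPlane, dif_neg h, measurable_const]

theorem restrict_extendHalfPlane (η : HalfPlaneConfig) :
    restrictHalfPlane (extendHalfPlane η) = η := by
  funext e
  exact dif_pos e.2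

/-- `extendHalfPlane` is a measurable section of the restriction, so measurability on the half-plane
follows from measurability of the pullback. -/
theorem ae_halfPlaneMarginal_iff {ν : Measure Config} {P : HalfPlaneConfig → Prop}
    (hP : MeasurableSet {ω | P (restrictHalfPlane ω)}) :
    (∀ᵐ η ∂(halfPlaneMarginal ν), P η) ↔ ∀ᵐ ω ∂ν, P (restrictHalfPlane ω) := by
  refine ae_map_iff measurable_restrictHalfPlane.aemeasurable ?_
  have : {η | P η} = extendHalfPlane ⁻¹' {ω | P (restrictHalfPlane ω)} := by
    ext η
    simp only [Set.mem_preimage, Set.mem_ofPred_eq, restrict_extendHalfPlane]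
  rw [this]
  exact measurable_extendHalfPlane hP

theorem ae_hasNoInfiniteCluster {ν : Measure Config} (h : ∀ᵐ ω ∂ν, ¬ ∃ v, InfAt ω 0 v) :
    ∀ᵐ η ∂(halfPlaneMarginal ν), HasNoInfiniteCluster η := by
  refine (ae_halfPlaneMarginal_iff ?_).2 (h.mono fun ω => hasNoInfiniteCluster_restrict.2)
  simp only [hasNoInfiniteCluster_restrict]
  exact (measurableSet_exists_infAt 0).compl

theorem ae_hasUniqueInfiniteCluster {ν : Measure Config} (h : ∀ᵐ ω ∂ν, ∃ v, InfAt ω 0 v)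
    (hd : ∀ᵐ ω ∂ν, ¬ ∃ v, InfAt (dualConfig ω) 0 v) :
    ∀ᵐ η ∂(halfPlaneMarginal ν), HasUniqueInfiniteCluster η := by
  refine (ae_halfPlaneMarginal_iff ?_).2 ?_
  · simp only [hasUniqueInfiniteCluster_restrict]
    have : {ω : Config | ∀ u v, InfAt ω 0 u → InfAt ω 0 v → Joined ω 0 u v} =
        ⋂ u, ⋂ v, ({ω | InfAt ω 0 u}ᶜ ∪ ({ω | InfAt ω 0 v}ᶜ ∪ {ω | Joined ω 0 u v})) := by
      ext ω
      simp only [Set.mem_ofPred_eq, Set.mem_iInter, Set.mem_union, Set.mem_compl_iff,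
        imp_iff_not_or]
    refine (measurableSet_exists_infAt 0).inter (MeasurableSet.congr ?_ this.symm)
    exact MeasurableSet.iInter fun u => MeasurableSet.iInter fun v =>
      (measurableSet_infAt 0 u).compl.union
        ((measurableSet_infAt 0 v).compl.union (measurableSet_joined 0 u v))
  · filter_upwards [h, hd] with ω h1 h2
    refine hasUniqueInfiniteCluster_restrict.2 ⟨h1, fun u v hu hv => ?_⟩
    by_contra hj
    exact h2 (exists_infAt_dual_of_not_joined hu hv hj)

end Percolation

/-! ### The trichotomy -/

open Percolation
theorem theorem1p1 (μ : Measure Config) (hprob : IsProbabilityMeasure μ)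
    (hinv : VAddInvariantMeasure (ℤ × ℤ) Config μ)
    (herg : ErgodicVAdd (ℤ × ℤ) Config μ)
    (hfe : HasFiniteEnergy μ) :
    ((∀ᵐ η ∂(halfPlaneMarginal μ), HasUniqueInfiniteCluster η) ∧
      (∀ᵐ η ∂(halfPlaneMarginal (dualMeasure μ)), HasNoInfiniteCluster η)) ∨
    ((∀ᵐ η ∂(halfPlaneMarginal (dualMeasure μ)), HasUniqueInfiniteCluster η) ∧
      (∀ᵐ η ∂(halfPlaneMarginal μ), HasNoInfiniteCluster η)) ∨
    ((∀ᵐ η ∂(halfPlaneMarginal μ), HasNoInfiniteCluster η) ∧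
      (∀ᵐ η ∂(halfPlaneMarginal (dualMeasure μ)), HasNoInfiniteCluster η)) := by
  have hmp : ∀ a : ℤ × ℤ, MeasurePreserving (fun ω : Config => a +ᵥ ω) μ μ := fun a =>
    ⟨measurable_vadd_config a, by
      ext s hs
      rw [Measure.map_apply (measurable_vadd_config a) hs]
      exact hinv.measure_preimage_vadd a hs⟩
  have hzo : ∀ s : Set Config, MeasurableSet s →
      (∀ a : ℤ × ℤ, (fun ω : Config => a +ᵥ ω) ⁻¹' s = s) →
      (∀ᵐ ω ∂μ, ω ∈ s) ∨ ∀ᵐ ω ∂μ, ω ∉ s := fun s hs hs' =>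
    Filter.eventuallyConst_set.1
      (herg.aeconst_of_forall_preimage_vadd_ae_eq hs fun a =>
      Filter.EventuallyEq.of_eq (hs' a))
  have hft := hfe.flipTolerant
  have hdm := measurable_dualConfig
  have : IsProbabilityMeasure (dualMeasure μ) := Measure.isProbabilityMeasure_map hdm.aemeasurable
  -- Duality commutes with translations, so invariant events pull back to invariant events.
  have hzo' : ∀ s : Set Config, MeasurableSet s →
      (∀ a : ℤ × ℤ, (fun ω : Config => a +ᵥ ω) ⁻¹' s = s) →
      (∀ᵐ ω ∂(dualMeasure μ), ω ∈ s) ∨ ∀ᵐ ω ∂(dualMeasure μ), ω ∉ s := by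
    intro s hs hs'
    refine (hzo (dualConfig ⁻¹' s) (hdm hs) fun a => ?_).imp
      (fun h => (ae_map_iff hdm.aemeasurable hs).2 h)
      (fun h => (ae_map_iff hdm.aemeasurable hs.compl).2 h)
    ext ω
    have := Set.ext_iff.1 (hs' a) (dualConfig ω)
    simpa only [Set.mem_preimage, dualConfig_vadd] using this
  have hmd := measurableSet_exists_infAt 0
  rcases ae_exists_infAt_or_ae_forall_not hmp hzo with hp | hp <;>
    rcases ae_exists_infAt_or_ae_forall_not (measurePreserving_dualMeasure hmp) hzo' with hd | hd
  · exfalso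
    have h := ae_forall_not_infAt_of_dual hmp hft (ae_of_ae_map hdm.aemeasurable hd)
    obtain ⟨ω, h1, h2⟩ := (hp.and h).exists
    exact h2 h1
  · exact Or.inl ⟨ae_hasUniqueInfiniteCluster hp (ae_of_ae_map hdm.aemeasurable hd),
      ae_hasNoInfiniteCluster hd⟩
  · refine Or.inr (Or.inl ⟨ae_hasUniqueInfiniteCluster hd ?_, ae_hasNoInfiniteCluster hp⟩)
    -- Up to translation, the bidual half-plane configuration is `ω` on `{y ≥ 1}`, so an infinite
    -- cluster of it gives one of `ω` on `{y ≥ 0}`.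
    refine (ae_map_iff hdm.aemeasurable (hdm hmd).compl).2 ?_
    filter_upwards [hp] with ω hω
    rintro ⟨v, hv⟩
    rw [dualConfig_dualConfig, infAt_vadd] at hv
    exact hω ⟨_, hv.mono (by simp)⟩
  · exact Or.inr (Or.inr ⟨ae_hasNoInfiniteCluster hp, ae_hasNoInfiniteCluster hd⟩)
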